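/- \textbf{Proposition.} Let $\mathcal{H}_0$ be a separable complex Hilbert space and let $\mathbb{T}=\mathbb{R}/2\pi\mathbb{Z}$. Let $p,q\ge 0$ be integers, let $\boldsymbol\theta(z)=\mathrm{Id}+\sum_{k=1}^q B_kz^k$ and $\boldsymbol\phi(z)=\mathrm{Id}-\sum_{k=1}^p A_kz^k$ have coefficients bounded operators on $\mathcal{H}_0$, and assume that $\boldsymbol\phi(z)$ is invertible for every $z\in\mathbb{C}$ with $|z|=1$. Let $Z=(Z_t)_{t\in\mathbb{Z}}$ be an $\mathcal{H}_0$-valued white noise in $L^2(\Omega,\mathcal{F},\mathbb{P};\mathcal{H}_0)$ (a centered weakly stationary process with constant spectral density), with covariance operator $\Sigma=\mathrm{Cov}(Z_0,Z_0)$ and spectral representation $Z_t=\int_{\mathbb{T}} e^{i\lambda t}\,\hat Z(d\lambda)$, $t\in\mathbb{Z}$, where $\hat Z$ is a countably additive gramian orthogonally scattered random measure. Let $X$ be the ARMA($p,q$) process $\hat X(d\lambda)=[\boldsymbol\phi(e^{-i\lambda})]^{-1}\boldsymbol\theta(e^{-i\lambda})\,\hat Z(d\lambda)$, that is, $$X_t=\int_{\mathbb{T}}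 e^{i\lambda t}\,[\boldsymbol\phi(e^{-i\lambda})]^{-1}\boldsymbol\theta(e^{-i\lambda})\,\hat Z(d\lambda),\qquad t\in\mathbb{Z}.$$ Then $X$ has a spectral density $g_X$ with respect to the normalised Lebesgue measure $d\lambda/2\pi$ on $\mathbb{T}$, i.e.\ $g_X$ is the density of the trace-class positive operator valued measure $\nu_X$ with $\mathrm{Cov}(X_h,X_0)=\int_{\mathbb{T}} e^{i\lambda h}\,\nu_X(d\lambda)$ for all $h\in\mathbb{Z}$. Moreover there exist $\eta\in(0,\pi)$ and a function $k$ from $(-\eta,\eta)$ to the space $\mathcal{S}_2(\mathcal{H}_0)$ of Hilbert--Schmidt operators, continuous and bounded for the Hilbert--Schmidt norm, such that for Lebesgue-almost every $\lambda\in(-\eta,\eta)$, $$g_X(\lambda)=h(\lambda)\,h(\lambda)^{\mathsf H}\qquad\text{with}\qquad h(\lambda)=[\boldsymbol\phi(1)]^{-1}\boldsymbol\theta(1)\,\Sigma^{1/2}+\lambda\,k(\lambda).$$ If $\mathcal{H}_0=L^2(\mathsf{V},\mathcal{V},\xi)$ for a $\sigma$-finite measure space $(\mathsf{V},\mathcal{V},\xi)$,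 then $\eta$ and $k$ can be chosen such that, in addition, $k$ has a joint kernel function, i.e.\ a jointly measurable $\mathsf{k}:\mathsf{V}^2\times(-\eta,\eta)\to\mathbb{C}$ such that for every $\lambda$ the function $\mathsf{k}(\cdot\,;\lambda)\in L^2(\mathsf{V}^2,\xi^{\otimes2})$ is the kernel of the integral operator $k(\lambda)$, and every such $\mathsf{k}$ belongs to $L^2(\mathsf{V}^2\times(-\eta,\eta),\xi^{\otimes2}\otimes\mathrm{Leb})$ and satisfies $$\int_{\mathsf{V}^2}\operatorname*{ess\,sup}_{\lambda\in(-\eta,\eta)}|\mathsf{k}(v,v';\lambda)|^2\,\xi(dv)\,\xi(dv')<+\infty.$$ -/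

import Mathlib

open MeasureTheory Filter Topology Set
open scoped ENNReal InnerProductSpace

noncomputable section

/-! ### Hilbert-Schmidt operators and the trace of a positive operator -/

section Operators

variable (H G : Type*) [NormedAddCommGroup H] [InnerProductSpace ℂ H] [CompleteSpace H]
  [NormedAddCommGroup G] [InnerProductSpace ℂ G]

/-- Index set of a Hilbert basis of `H` chosen once and for all. -/
def onbIndex : Set H := (exists_hilbertBasis ℂ H).choose

/-- A Hilbert basis of `H` chosen once and for all. -/
def onb : HilbertBasis (onbIndex H) ℂ H := (exists_hilbertBasis ℂ H).choose_spec.choose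

/-- The Hilbert-Schmidt operators `H → G`: those with `∑ ‖T eᵢ‖² < ∞`, as a submodule. -/
def hsSubmodule : Submodule ℂ (H →L[ℂ] G) where
  carrier := {T | Memℓp (fun i => T (onb H i)) 2}
  add_mem' hS hT := by simpa using! hS.add hT
  zero_mem' := by simpa using! zero_memℓp
  smul_mem' c _ hT := by simpa using! hT.const_smul c

/-- The Schatten-2 class. This is a type synonym, so that it carries the Hilbert-Schmidt
norm below rather than the operator norm. -/
def HilbertSchmidt : Type _ := ↥(hsSubmodule H G)

instance : AddCommGroup (HilbertSchmidt H G) := inferInstanceAs (AddCommGroup ↥(hsSubmodule H G))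

instance : Module ℂ (HilbertSchmidt H G) := inferInstanceAs (Module ℂ ↥(hsSubmodule H G))

variable {H G}

/-- The bounded operator underlying a Hilbert-Schmidt operator. -/
def HilbertSchmidt.toOp : HilbertSchmidt H G →ₗ[ℂ] (H →L[ℂ] G) := (hsSubmodule H G).subtype

/-- The family `(T eᵢ)ᵢ`, as an element of the Hilbert sum of copies of `G`. -/
def HilbertSchmidt.toLp : HilbertSchmidt H G →ₗ[ℂ] lp (fun _ : onbIndex H => G) 2 where
  toFun T := ⟨fun i => T.toOp (onb H i), T.2⟩
  map_add' _ _ := rfl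
  map_smul' _ _ := rfl

theorem HilbertSchmidt.toLp_injective :
    Function.Injective (HilbertSchmidt.toLp : HilbertSchmidt H G → _) := by
  intro S T h
  apply Subtype.ext
  have h1 : ∀ i, S.toOp (onb H i) = T.toOp (onb H i) := fun i =>
    congrFun (congrArg Subtype.val h) i
  have hd := (onb H).dense_span
  refine ContinuousLinearMap.ext_on (s := Set.range (onb H)) ?_ ?_
  · rw [← Submodule.dense_iff_topologicalClosure_eq_top] at hd
    exact hd
  · rintro _ ⟨i, rfl⟩
    exact h1 i

/-- The Hilbert-Schmidt norm `‖T‖₂ = (∑ ‖T eᵢ‖²)^{1/2}`. -/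
instance : NormedAddCommGroup (HilbertSchmidt H G) :=
  NormedAddCommGroup.induced _ _ HilbertSchmidt.toLp HilbertSchmidt.toLp_injective

instance : NormedSpace ℂ (HilbertSchmidt H G) :=
  NormedSpace.induced ℂ _ _ HilbertSchmidt.toLp

/-- The trace `∑ ⟪eᵢ, T eᵢ⟫ ∈ [0, ∞]` of a positive operator `T`; such a `T` is trace-class
(and then its Schatten-1 norm is this number) if and only if it is finite. -/
def posTrace (T : H →L[ℂ] H) : ℝ≥0∞ := ∑' i, ENNReal.ofReal (⟪onb H i, T (onb H i)⟫_ℂ).re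


set_option linter.unusedSectionVars false in
theorem parseval_enorm {ι : Type*} (b : HilbertBasis ι ℂ H) (x : H) :
    ∑' i, ‖⟪b i, x⟫_ℂ‖ₑ ^ 2 = ‖x‖ₑ ^ 2 := by
  have h := b.hasSum_inner_mul_inner x x
  have h2 : HasSum (fun i => ‖⟪b i, x⟫_ℂ‖ ^ 2) (‖x‖ ^ 2) := by
    have h3 := Complex.hasSum_re h
    convert h3 using 1
    · funext i
      have h5 := inner_mul_symm_re_eq_norm (𝕜 := ℂ) x (b i)
      rw [norm_mul, norm_inner_symm, ← sq] at h5
      exact h5.symm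
    · exact (inner_self_eq_norm_sq (𝕜 := ℂ) x).symm
  have h4 := ENNReal.ofReal_tsum_of_nonneg (fun i => sq_nonneg ‖⟪b i, x⟫_ℂ‖) h2.summable
  rw [h2.tsum_eq] at h4
  simpa [ENNReal.ofReal_pow, ofReal_norm] using h4.symm

theorem tsum_enorm_sq_adjoint [CompleteSpace G] {ι κ : Type*} (b : HilbertBasis ι ℂ H) (c : HilbertBasis κ ℂ G)
    (T : H →L[ℂ] G) :
    ∑' i, ‖T (b i)‖ₑ ^ 2 = ∑' j, ‖T.adjoint (c j)‖ₑ ^ 2 := by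
  simp_rw [← parseval_enorm c (T _), ← parseval_enorm b (T.adjoint _)]
  rw [ENNReal.tsum_comm]
  refine tsum_congr fun j => tsum_congr fun i => ?_
  rw [ContinuousLinearMap.adjoint_inner_right, ← inner_conj_symm, RCLike.enorm_conj]

/-- The Hilbert-Schmidt norm does not depend on the basis. -/
theorem HilbertSchmidt.enorm_sq [CompleteSpace G] {ι : Type*} (b : HilbertBasis ι ℂ H) (T : HilbertSchmidt H G) :
    ‖T‖ₑ ^ 2 = ∑' i, ‖T.toOp (b i)‖ₑ ^ 2 := by
  rw [tsum_enorm_sq_adjoint b (onb G), ← tsum_enorm_sq_adjoint (onb H) (onb G)]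
  have h : HasSum (fun i => ‖T.toOp (onb H i)‖ ^ 2) (‖T‖ ^ 2) := by
    have := lp.hasSum_norm (p := 2) (by norm_num) (HilbertSchmidt.toLp T)
    simpa using! this
  have h4 := ENNReal.ofReal_tsum_of_nonneg (fun i => sq_nonneg ‖T.toOp (onb H i)‖) h.summable
  rw [h.tsum_eq] at h4
  simpa [ENNReal.ofReal_pow, ofReal_norm] using h4

/-- The trace of a positive operator does not depend on the basis. -/
theorem posTrace_eq {ι : Type*} (b : HilbertBasis ι ℂ H) (T : H →L[ℂ] H) (hT : T.IsPositive) :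
    posTrace T = ∑' i, ENNReal.ofReal (⟪b i, T (b i)⟫_ℂ).re := by
  have h0 : 0 ≤ T := (ContinuousLinearMap.nonneg_iff_isPositive T).2 hT
  have hs : (CFC.sqrt T).IsPositive :=
    (ContinuousLinearMap.nonneg_iff_isPositive _).1 (CFC.sqrt_nonneg T)
  have hm : CFC.sqrt T * CFC.sqrt T = T := CFC.sqrt_mul_sqrt_self T
  have key : ∀ x, ENNReal.ofReal (⟪x, T x⟫_ℂ).re = ‖CFC.sqrt T x‖ₑ ^ 2 := fun x => by
    have h1 : ⟪x, T x⟫_ℂ = ⟪CFC.sqrt T x, CFC.sqrt T x⟫_ℂ := by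
      conv_lhs => rw [← hm]
      exact (hs.isSymmetric x (CFC.sqrt T x)).symm
    rw [h1, ← ofReal_norm, ← ENNReal.ofReal_pow (norm_nonneg _)]
    congr 1
    exact inner_self_eq_norm_sq (𝕜 := ℂ) _
  unfold posTrace
  simp_rw [key]
  rw [tsum_enorm_sq_adjoint b (onb H), ← tsum_enorm_sq_adjoint (onb H) (onb H)]

end Operators

/-! ### Hilbert-valued weakly stationary time series and their spectral representation -/

instance fact_two_pi_pos : Fact (0 < 2 * Real.pi) := ⟨Real.two_pi_pos⟩

/-- The torus `ℝ / 2πℤ`. The normalised Lebesgue measure `dλ / 2π` on it is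
`AddCircle.haarAddCircle`, and `fourier n` is `λ ↦ exp (i n λ)`. -/
abbrev Torus : Type := AddCircle (2 * Real.pi)

section TimeSeries

variable {H : Type*} [NormedAddCommGroup H] [InnerProductSpace ℂ H] [CompleteSpace H]
variable {Ω : Type*} [MeasurableSpace Ω] (P : Measure Ω)

/-- The covariance operator `Cov(X, Y) = E[(X - E X) (Y - E Y)ᴴ]`. -/
def crossCov (X Y : Ω → H) : H →L[ℂ] H :=
  ∫ ω, InnerProductSpace.rankOne ℂ (X ω - ∫ ω', X ω' ∂P) (Y ω - ∫ ω', Y ω' ∂P) ∂P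

/-- Weak stationarity of an `H`-valued time series in `L²`. -/
structure IsWeaklyStationary (X : ℤ → Lp H 2 P) : Prop where
  mean_eq : ∀ t, ∫ ω, X t ω ∂P = ∫ ω, X 0 ω ∂P
  cov_eq : ∀ t h, crossCov P (X (t + h)) (X t) = crossCov P (X h) (X 0)

/-- The time series is centered. -/
def IsCentered (X : ℤ → Lp H 2 P) : Prop := ∀ t, ∫ ω, X t ω ∂P = 0

/-- Trace-class positive operator valued measure. (For positive operators with finite
trace, countable additivity in operator norm and in trace norm are the same.) -/
structure IsTraceClassPOVM (ν : VectorMeasure Torus (H →L[ℂ] H)) : Prop where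
  isPositive : ∀ A, MeasurableSet A → (ν A).IsPositive
  trace_lt_top : ∀ A, MeasurableSet A → posTrace (ν A) < ∞

/-- `g`, a trace-norm integrable function with positive values, is the operator density
of the operator-valued set function `ν` with respect to `μ`: `ν(A) = ∫_A g dμ`. -/
structure IsOperatorDensity (ν : Set Torus → H →L[ℂ] H) (μ : Measure Torus)
    (g : Torus → H →L[ℂ] H) : Prop where
  aestronglyMeasurable : AEStronglyMeasurable g μ
  isPositive : ∀ᵐ x ∂μ, (g x).IsPositive
  lintegral_trace_lt_top : ∫⁻ x, posTrace (g x) ∂μ < ∞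
  eq_integral : ∀ A, MeasurableSet A → ν A = ∫ x in A, g x ∂μ

/-- `ν` is the spectral operator measure of the centered weakly stationary time series `X`:
the trace-class p.o.v.m. with `Γ_X(h) = ∫ exp (iλh) ν(dλ)` for all `h`. -/
structure IsSpectralOperatorMeasure (X : ℤ → Lp H 2 P) (ν : VectorMeasure Torus (H →L[ℂ] H)) :
    Prop where
  centered : IsCentered P X
  weaklyStationary : IsWeaklyStationary P X
  povm : IsTraceClassPOVM ν
  autocov : ∀ h : ℤ, crossCov P (X h) (X 0) =
    ν.integral (fun x => (fourier h x : ℂ)) (ContinuousLinearMap.lsmul ℝ ℂ)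

/-- `g` is the spectral density of `X` with respect to the normalised Lebesgue measure. -/
def IsSpectralDensity (X : ℤ → Lp H 2 P) (g : Torus → H →L[ℂ] H) : Prop :=
  ∃ ν : VectorMeasure Torus (H →L[ℂ] H), IsSpectralOperatorMeasure P X ν ∧
    IsOperatorDensity ν AddCircle.haarAddCircle g

/-- White noise: centered and weakly stationary with a constant spectral density. -/
def IsWhiteNoise (Z : ℤ → Lp H 2 P) : Prop :=
  ∃ S : H →L[ℂ] H, IsSpectralDensity P Z (fun _ => S)

/-- Countably additive gramian orthogonally scattered random measure: an `L²`-valued measure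
with centered values, such that disjoint sets have zero cross-covariance operator. -/
structure IsCAGOS (W : VectorMeasure Torus (Lp H 2 P)) : Prop where
  centered : ∀ A, MeasurableSet A → ∫ ω, W A ω ∂P = 0
  orthogonal : ∀ A B, MeasurableSet A → MeasurableSet B → Disjoint A B →
    crossCov P (W A) (W B) = 0

variable {P}

/-- The integral `∑ᵢ Tᵢ W(Aᵢ)` of the operator-valued simple function `∑ᵢ Tᵢ 1_{Aᵢ}`. -/
def simpleOpIntegral (W : VectorMeasure Torus (Lp H 2 P)) (S : SimpleFunc Torus (H →L[ℂ] H)) :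
    Lp H 2 P :=
  ∑ T ∈ S.range, T.compLp (W (S ⁻¹' {T}))

/-- `Y = ∫ Φ dW` for a simply measurable operator-valued function `Φ`: with `g` the operator
density of the intensity measure `A ↦ Cov(W(A), W(A))` of `W` with respect to a finite measure
`μ` which dominates it, `Y` is the limit in `L²` of integrals of simple functions `Sₙ` with
`∫ ‖(Sₙ - Φ) g (Sₙ - Φ)ᴴ‖₁ dμ → 0`. -/
def HasOpIntegral (W : VectorMeasure Torus (Lp H 2 P)) (Φ : Torus → H →L[ℂ] H)
    (Y : Lp H 2 P) : Prop :=
  (∀ v : H, StronglyMeasurable fun x => Φ x v) ∧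
  ∃ (μ : Measure Torus) (g : Torus → H →L[ℂ] H), IsFiniteMeasure μ ∧
    IsOperatorDensity (fun A => crossCov P (W A) (W A)) μ g ∧
    ∃ S : ℕ → SimpleFunc Torus (H →L[ℂ] H),
      Tendsto (fun n => ∫⁻ x, posTrace ((S n x - Φ x) * g x * (S n x - Φ x).adjoint) ∂μ)
        atTop (𝓝 0) ∧
      Tendsto (fun n => simpleOpIntegral W (S n)) atTop (𝓝 Y)

/-- `X` is obtained by filtering with transfer operator function `Φ` the series whose spectral
representation is `W`: `X_t = ∫ exp (iλt) Φ(λ) W(dλ)` for all `t`. -/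
def IsFiltered (W : VectorMeasure Torus (Lp H 2 P)) (Φ : Torus → H →L[ℂ] H)
    (X : ℤ → Lp H 2 P) : Prop :=
  ∀ t : ℤ, HasOpIntegral W (fun x => (fourier t x : ℂ) • Φ x) (X t)

/-- `W` is the spectral representation of `Z`: `Z_t = ∫ exp (iλt) W(dλ)` for all `t`. -/
def IsSpectralRepresentation (W : VectorMeasure Torus (Lp H 2 P)) (Z : ℤ → Lp H 2 P) : Prop :=
  IsCAGOS P W ∧ IsFiltered W (fun _ => 1) Z

/-! ### ARMA processes -/

/-- Value at the complex number `z` of a polynomial with operator coefficients. -/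
def opEval (p : Polynomial (H →L[ℂ] H)) (z : ℂ) : H →L[ℂ] H := p.sum fun n A => z ^ n • A

variable (H) in
/-- Operator polynomials of degree (at most) `d` whose value at `0` is the identity. -/
def polySet (d : ℕ) : Set (Polynomial (H →L[ℂ] H)) := {p | p.natDegree ≤ d ∧ opEval p 0 = 1}

variable (H) in
/-- The elements of `polySet H d` that are invertible on the complex unit circle. -/
def polySetInv (d : ℕ) : Set (Polynomial (H →L[ℂ] H)) :=
  {p | p ∈ polySet H d ∧ ∀ z : ℂ, ‖z‖ = 1 → IsUnit (opEval p z)}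

/-- The transfer function `λ ↦ φ(e^{-iλ})⁻¹ θ(e^{-iλ})`. -/
def armaTransfer (φ θ : Polynomial (H →L[ℂ] H)) (x : Torus) : H →L[ℂ] H :=
  Ring.inverse (opEval φ (fourier (-1) x)) * opEval θ (fourier (-1) x)

/-- `X` is the ARMA process `X̂(dλ) = φ(e^{-iλ})⁻¹ θ(e^{-iλ}) Ẑ(dλ)`, with `Ẑ` the spectral
representation of `Z`. -/
def IsARMA (φ θ : Polynomial (H →L[ℂ] H)) (Z X : ℤ → Lp H 2 P) : Prop :=
  ∃ W : VectorMeasure Torus (Lp H 2 P), IsSpectralRepresentation W Z ∧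
    IsFiltered W (armaTransfer φ θ) X

/-- `h(λ) = φ(1)⁻¹ θ(1) Σ^{1/2} + λ k(λ)`. -/
def armaLocalFactor (φ θ : Polynomial (H →L[ℂ] H)) (S : H →L[ℂ] H) {η : ℝ}
    (k : Ioo (-η) η → HilbertSchmidt H H) (x : Ioo (-η) η) : H →L[ℂ] H :=
  Ring.inverse (opEval φ 1) * opEval θ 1 * CFC.sqrt S + (x : ℂ) • (k x).toOp

end TimeSeries

/-- Lebesgue measure on the interval `(-η, η)`. -/
def lebOn (η : ℝ) : Measure (Ioo (-η) η) := Measure.comap Subtype.val volume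

/-- `κ` is a `Λ`-joint kernel function of `K`: it is jointly measurable and, for every `l`,
`κ(·; l)` is the square-integrable kernel of the integral operator `K(l)`. -/
structure IsJointKernel {V Λ : Type*} [MeasurableSpace V] [MeasurableSpace Λ] (ξ : Measure V)
    (K : Λ → HilbertSchmidt (Lp ℂ 2 ξ) (Lp ℂ 2 ξ)) (κ : (V × V) × Λ → ℂ) : Prop where
  measurable : Measurable κ
  memLp : ∀ l, MemLp (fun z => κ (z, l)) 2 (ξ.prod ξ)
  apply_eq : ∀ l (f : Lp ℂ 2 ξ),
    (K l).toOp f =ᵐ[ξ] fun v => ∫ v', κ ((v, v'), l) * f v' ∂ξ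

end

noncomputable section

/-! ### Hilbert-Schmidt operators and traces -/

section Operators

variable {H : Type*} [NormedAddCommGroup H] [InnerProductSpace ℂ H] [CompleteSpace H]

/-! Write Φ(λ) = φ(e^{-iλ})⁻¹ θ(e^{-iλ}), W for the spectral representation of Z and Σ = Cov(Z₀,
Z₀).

Spectral density. Orthogonality of W on disjoint sets gives the gramian isometry
`secondMoment_eq_integral`: second moments of operator integrals against W are integrals of Φ g Ψᴴ
dμ, where g dμ is the intensity measure of W. Applied to Z itself, it identifies the Fourier
coefficients of g dμ with the autocovariances of a white noise, that is, with those of the constant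
density Σ; since an operator measure is determined by its Fourier coefficients
(`setIntegral_eq_of_fourier`), the intensity is Σ dλ/2π (`isOperatorDensity_of_isWhiteNoise`).
Applied to X, it gives the spectral density Φ Σ Φᴴ (`isSpectralDensity_of_isFiltered`), unique
almost everywhere by Fourier uniqueness again.

Local factor. Inversion is analytic on the units of a Banach algebra, so Φ is a norm-convergent
power series near 0 and Φ(λ) = Φ(0) + λ K(λ), with K again a power series
(`exists_local_expansion`). As Σ is positive and trace class, Σ^{1/2} is Hilbert-Schmidt, and h = Φ
Σ^{1/2}, k = K Σ^{1/2} have the required form: A ↦ A Σ^{1/2} is continuous from the operator norm to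
the Hilbert-Schmidt norm.

Joint kernel. On L²(ξ), passing from a Hilbert-Schmidt operator to its kernel in L²(ξ ⊗ ξ) is
isometric, so the kernel of k is a power series with coefficients cₙ in L² and ∑ ‖cₙ‖ ηⁿ < ∞. The
pointwise sum M = ∑ ηⁿ |cₙ| is square integrable and dominates the kernel for all λ at once.
Uniqueness of kernels and Fubini carry this bound over to every joint kernel. -/

/-- The diagonal entries of B Bᴴ are ‖Bᴴ eᵢ‖², and B and Bᴴ have the same Hilbert-Schmidt sum. -/
theorem posTrace_mul_adjoint (B : H →L[ℂ] H) :
    posTrace (B * B.adjoint) = ∑' i, ‖B (onb H i)‖ₑ ^ 2 := by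
  rw [tsum_enorm_sq_adjoint (onb H) (onb H)]
  refine tsum_congr fun i => ?_
  rw [← ofReal_norm, ← ENNReal.ofReal_pow (norm_nonneg _)]
  congr 1
  rw [mul_apply_eq_comp, ← ContinuousLinearMap.adjoint_inner_left]
  exact inner_self_eq_norm_sq (𝕜 := ℂ) _

/-- The coordinates of B x are ⟪Bᴴ eᵢ, x⟫, so Cauchy-Schwarz applies coordinate by coordinate. This
is what bounds the operator norm by the Hilbert-Schmidt norm. -/
theorem enorm_apply_sq_le (B : H →L[ℂ] H) (x : H) :
    ‖B x‖ₑ ^ 2 ≤ (∑' i, ‖B (onb H i)‖ₑ ^ 2) * ‖x‖ₑ ^ 2 := by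
  rw [tsum_enorm_sq_adjoint (onb H) (onb H), ← parseval_enorm (onb H) (B x), ← ENNReal.tsum_mul_right]
  refine ENNReal.tsum_le_tsum fun i => ?_
  rw [← ContinuousLinearMap.adjoint_inner_left, ← mul_pow]
  gcongr
  simp only [← ofReal_norm, ← ENNReal.ofReal_mul (norm_nonneg _)]
  exact ENNReal.ofReal_le_ofReal (norm_inner_le_norm _ _)

theorem enorm_sq_le_tsum (B : H →L[ℂ] H) : ‖B‖ₑ ^ 2 ≤ ∑' i, ‖B (onb H i)‖ₑ ^ 2 := by
  by_cases htop : ∑' i, ‖B (onb H i)‖ₑ ^ 2 = ∞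
  · simp [htop]
  set a := (∑' i, ‖B (onb H i)‖ₑ ^ 2).toReal with ha
  have ha0 : 0 ≤ a := ENNReal.toReal_nonneg
  have h1 : ‖B‖ ≤ √a := by
    refine ContinuousLinearMap.opNorm_le_bound _ (Real.sqrt_nonneg _) fun x => ?_
    have h := enorm_apply_sq_le B x
    rw [← ENNReal.ofReal_toReal htop, ← ha] at h
    simp only [← ofReal_norm, ← ENNReal.ofReal_pow (norm_nonneg _), ← ENNReal.ofReal_mul ha0] at h
    rw [ENNReal.ofReal_le_ofReal_iff (by positivity)] at h
    refine le_of_sq_le_sq ?_ (by positivity)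
    rwa [mul_pow, Real.sq_sqrt ha0]
  rw [← ENNReal.ofReal_toReal htop, ← ha, ← ofReal_norm, ← ENNReal.ofReal_pow (norm_nonneg _)]
  apply ENNReal.ofReal_le_ofReal
  calc ‖B‖ ^ 2 ≤ √a ^ 2 := by gcongr
    _ = a := Real.sq_sqrt ha0

theorem enorm_mul_adjoint (A B : H →L[ℂ] H) : ‖A * B.adjoint‖ₑ ≤ ‖A‖ₑ * ‖B‖ₑ := by
  refine (ContinuousLinearMap.opENorm_comp_le A B.adjoint).trans ?_
  gcongr
  simp only [← ofReal_norm]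
  exact ENNReal.ofReal_le_ofReal (by simp)

theorem ContinuousLinearMap.IsPositive.sqrt_mul_adjoint_sqrt {T : H →L[ℂ] H} (hT : T.IsPositive) :
    CFC.sqrt T * (CFC.sqrt T).adjoint = T := by
  have h0 : 0 ≤ T := (ContinuousLinearMap.nonneg_iff_isPositive T).2 hT
  have hs : (CFC.sqrt T).IsPositive :=
    (ContinuousLinearMap.nonneg_iff_isPositive _).1 (CFC.sqrt_nonneg T)
  rw [hs.isSelfAdjoint.adjoint_eq]
  exact CFC.sqrt_mul_sqrt_self T

/-- Splitting T as a product of square roots reduces every estimate on A T Bᴴ to a product C Dᴴ. -/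
theorem sandwich_eq {T : H →L[ℂ] H} (hT : T.IsPositive) (A B : H →L[ℂ] H) :
    A * T * B.adjoint = (A * CFC.sqrt T) * (B * CFC.sqrt T).adjoint := by
  conv_lhs => rw [← hT.sqrt_mul_adjoint_sqrt]
  have : (B * CFC.sqrt T).adjoint = (CFC.sqrt T).adjoint * B.adjoint :=
    ContinuousLinearMap.adjoint_comp _ _
  rw [this]; simp only [mul_assoc]

theorem isPositive_mul_adjoint (B : H →L[ℂ] H) : (B * B.adjoint).IsPositive := by
  rw [← ContinuousLinearMap.nonneg_iff_isPositive]
  exact mul_star_self_nonneg B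

theorem isPositive_sandwich {T : H →L[ℂ] H} (hT : T.IsPositive) (A : H →L[ℂ] H) :
    (A * T * A.adjoint).IsPositive := by
  rw [sandwich_eq hT]; exact isPositive_mul_adjoint _

theorem enorm_le_posTrace {T : H →L[ℂ] H} (hT : T.IsPositive) : ‖T‖ₑ ≤ posTrace T := by
  have h := hT.sqrt_mul_adjoint_sqrt
  calc ‖T‖ₑ = ‖CFC.sqrt T * (CFC.sqrt T).adjoint‖ₑ := by rw [h]
    _ ≤ ‖CFC.sqrt T‖ₑ * ‖CFC.sqrt T‖ₑ := enorm_mul_adjoint _ _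
    _ ≤ posTrace (CFC.sqrt T * (CFC.sqrt T).adjoint) := by
      rw [posTrace_mul_adjoint, ← sq]; exact enorm_sq_le_tsum _
    _ = posTrace T := by rw [h]

theorem enorm_mul_adjoint_self (B : H →L[ℂ] H) : ‖B * B.adjoint‖ₑ = ‖B‖ₑ ^ 2 := by
  rw [← ofReal_norm, ← ofReal_norm, ← ENNReal.ofReal_pow (norm_nonneg _), sq]
  congr 1
  exact CStarRing.norm_self_mul_star

/-- Cauchy-Schwarz inequality for the operator-valued form `(A, B) ↦ A T Bᴴ`. -/
theorem enorm_sandwich_le {T : H →L[ℂ] H} (hT : T.IsPositive) (A B : H →L[ℂ] H) :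
    ‖A * T * B.adjoint‖ₑ ≤ ‖A * T * A.adjoint‖ₑ ^ (1 / 2 : ℝ) * ‖B * T * B.adjoint‖ₑ ^ (1 / 2 : ℝ) := by
  have h2 : ∀ x : ℝ≥0∞, (x ^ 2) ^ (1 / 2 : ℝ) = x := fun x => by
    rw [← ENNReal.rpow_natCast, ← ENNReal.rpow_mul]; norm_num
  -- By the C*-identity the right side is exactly ‖A √T‖ ‖B √T‖, so submultiplicativity of the norm
  -- is all that remains.
  simp only [sandwich_eq hT, enorm_mul_adjoint_self, h2]
  exact enorm_mul_adjoint _ _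

theorem tsum_enorm_sq_mul_le (A R : H →L[ℂ] H) :
    ∑' i, ‖(A * R) (onb H i)‖ₑ ^ 2 ≤ ‖A‖ₑ ^ 2 * ∑' i, ‖R (onb H i)‖ₑ ^ 2 := by
  rw [← ENNReal.tsum_mul_left]
  refine ENNReal.tsum_le_tsum fun i => ?_
  rw [← mul_pow]
  gcongr
  exact A.le_opENorm _

theorem posTrace_sandwich_le {T : H →L[ℂ] H} (hT : T.IsPositive) (A : H →L[ℂ] H) :
    posTrace (A * T * A.adjoint) ≤ ‖A‖ₑ ^ 2 * posTrace T := by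
  calc posTrace (A * T * A.adjoint) ≤ ‖A‖ₑ ^ 2 * ∑' i, ‖CFC.sqrt T (onb H i)‖ₑ ^ 2 := by
        rw [sandwich_eq hT, posTrace_mul_adjoint]; exact tsum_enorm_sq_mul_le _ _
    _ = ‖A‖ₑ ^ 2 * posTrace T := by rw [← posTrace_mul_adjoint, hT.sqrt_mul_adjoint_sqrt]

theorem memℓp_of_tsum_lt_top {R : H →L[ℂ] H} (hR : ∑' i, ‖R (onb H i)‖ₑ ^ 2 < ∞) :
    Memℓp (fun i => R (onb H i)) 2 := by
  rw [memℓp_gen_iff (by norm_num)]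
  have : ∑' i, ENNReal.ofReal (‖R (onb H i)‖ ^ 2) ≠ ∞ := by
    simpa [ENNReal.ofReal_pow, ofReal_norm] using hR.ne
  have := ENNReal.summable_toReal this
  refine this.congr fun i => ?_
  rw [ENNReal.toReal_ofReal (by positivity)]
  norm_num

theorem HilbertSchmidt.tsum_lt_top (T : HilbertSchmidt H H) :
    ∑' i, ‖T.toOp (onb H i)‖ₑ ^ 2 < ∞ := by
  rw [← HilbertSchmidt.enorm_sq]
  exact ENNReal.pow_lt_top enorm_lt_top

/-- Composition `A ↦ A R` with a Hilbert-Schmidt operator, as a continuous map from the bounded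
operators to the Hilbert-Schmidt operators. -/
def HilbertSchmidt.mulLeft (R : HilbertSchmidt H H) : (H →L[ℂ] H) →L[ℂ] HilbertSchmidt H H :=
  LinearMap.mkContinuous
    { toFun := fun A => ⟨A * R.toOp, memℓp_of_tsum_lt_top ((tsum_enorm_sq_mul_le A R.toOp).trans_lt
        (ENNReal.mul_lt_top (ENNReal.pow_lt_top enorm_lt_top) R.tsum_lt_top))⟩
      map_add' := fun A B => Subtype.ext (add_mul A B R.toOp)
      map_smul' := fun c A => Subtype.ext (smul_mul_assoc c A R.toOp) } ‖R‖ fun A => by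
    refine le_of_sq_le_sq ?_ (by positivity)
    rw [← ENNReal.ofReal_le_ofReal_iff (by positivity), ENNReal.ofReal_pow (norm_nonneg _),
      ENNReal.ofReal_pow (by positivity), ENNReal.ofReal_mul (norm_nonneg _), ofReal_norm,
      ofReal_norm, ofReal_norm, mul_pow, mul_comm (_ ^ 2), HilbertSchmidt.enorm_sq (onb H),
      HilbertSchmidt.enorm_sq (onb H)]
    exact tsum_enorm_sq_mul_le A R.toOp

theorem HilbertSchmidt.toOp_mulLeft (R : HilbertSchmidt H H) (A : H →L[ℂ] H) :
    (R.mulLeft A).toOp = A * R.toOp := rfl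

/-- The square root of a positive trace-class operator is Hilbert-Schmidt. -/
theorem exists_hilbertSchmidt_sqrt {T : H →L[ℂ] H} (hT : T.IsPositive) (htr : posTrace T < ∞) :
    ∃ R : HilbertSchmidt H H, R.toOp = CFC.sqrt T := by
  refine ⟨⟨CFC.sqrt T, memℓp_of_tsum_lt_top ?_⟩, rfl⟩
  rwa [← posTrace_mul_adjoint, hT.sqrt_mul_adjoint_sqrt]

/-- The trace of the integral of positive operators with bounded trace. -/
theorem posTrace_integral_lt_top {α : Type*} [MeasurableSpace α] {μ : Measure α} [IsFiniteMeasure μ]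
    {G : α → H →L[ℂ] H} (hG : Integrable G μ) (hpos : ∀ x, (G x).IsPositive) {C : ℝ≥0∞}
    (hC : C < ∞) (htr : ∀ x, posTrace (G x) ≤ C) : posTrace (∫ x, G x ∂μ) < ∞ := by
  refine lt_of_le_of_lt ?_ (ENNReal.mul_lt_top hC (measure_lt_top μ univ))
  -- Only finite partial sums are exchanged with the integral, so the basis need not be countable.
  refine ENNReal.summable.tsum_le_of_sum_le fun F => ?_
  have hint : ∀ i, Integrable (fun x => (⟪onb H i, G x (onb H i)⟫_ℂ).re) μ := fun i =>
    ((hG.apply_continuousLinearMap (onb H i)).const_inner (𝕜 := ℂ) (onb H i)).re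
  have h1 : ∀ i, ENNReal.ofReal (⟪onb H i, (∫ x, G x ∂μ) (onb H i)⟫_ℂ).re =
      ∫⁻ x, ENNReal.ofReal (⟪onb H i, G x (onb H i)⟫_ℂ).re ∂μ := fun i => by
    rw [← ofReal_integral_eq_lintegral_ofReal (hint i)
      (Eventually.of_forall fun x => (hpos x).re_inner_nonneg_right _),
      ContinuousLinearMap.integral_apply hG,
      ← integral_inner (hG.apply_continuousLinearMap (onb H i))]
    congr 1
    exact (integral_re (𝕜 := ℂ) ((hG.apply_continuousLinearMap (onb H i)).const_inner (𝕜 := ℂ) (onb H i))).symm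
  simp_rw [h1]
  rw [← lintegral_finsetSum' _ fun i _ => (hint i).aestronglyMeasurable.aemeasurable.ennreal_ofReal]
  calc _ ≤ ∫⁻ _, C ∂μ := lintegral_mono fun x => (ENNReal.sum_le_tsum F).trans (htr x)
    _ = C * μ univ := lintegral_const _

end Operators

/-! ### Vector measures with a density and their Fourier coefficients -/

section Density

variable {X E : Type*} [MeasurableSpace X] [NormedAddCommGroup E] [NormedSpace ℂ E]
  [CompleteSpace E]

theorem isFiniteMeasure_variation_withDensityᵥ {μ : Measure X} {g : X → E} (hg : Integrable g μ) :
    IsFiniteMeasure (μ.withDensityᵥ g).variation := by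
  rw [Measure.variation_withDensityᵥ hg]
  exact ⟨by simpa using! hg.2⟩

theorem integral_withDensityᵥ_simpleFunc {μ : Measure X} {g : X → E} (hg : Integrable g μ)
    (f : SimpleFunc X ℂ) :
    (μ.withDensityᵥ g).integral f (ContinuousLinearMap.lsmul ℝ ℂ) = ∫ x, f x • g x ∂μ := by
  have := isFiniteMeasure_variation_withDensityᵥ hg
  have hb : ∀ u : SimpleFunc X ℂ, Integrable (fun x => u x • g x) μ := fun u => by
    obtain ⟨C, hC⟩ := u.exists_forall_norm_le
    exact hg.bdd_smul C u.stronglyMeasurable.aestronglyMeasurable (Eventually.of_forall hC)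
  induction f using SimpleFunc.induction with
  | @const c s hs =>
    have h1 : (SimpleFunc.piecewise s hs (SimpleFunc.const X c) (SimpleFunc.const X 0) : X → ℂ)
        = s.indicator fun _ => c := by simp; rfl
    rw [h1, VectorMeasure.integral_indicator_const _ hs, withDensityᵥ_apply hg hs]
    have h2 : ∀ x, (s.indicator (fun _ => c) x) • g x = s.indicator (fun x => c • g x) x := fun x => by
      by_cases hx : x ∈ s <;> simp [hx]
    simp_rw [h2]
    rw [integral_indicator hs, integral_smul]
    rfl
  | @add u v _ hu hv =>
    have hi : ∀ w : SimpleFunc X ℂ, (μ.withDensityᵥ g).Integrable w := fun w =>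
      w.integrable_of_isFiniteMeasure
    rw [SimpleFunc.coe_add, VectorMeasure.integral_add (hi u) (hi v), hu, hv]
    simp_rw [Pi.add_apply, add_smul]
    exact (integral_add (hb u) (hb v)).symm

/-- Bounded simple approximations pass to the limit on both sides by dominated convergence. This
turns the vector-measure integral in the autocovariance formula into a Bochner integral. -/
theorem integral_withDensityᵥ {μ : Measure X} {g : X → E} (hg : Integrable g μ)
    {f : X → ℂ} (hf : StronglyMeasurable f) {C : ℝ} (hC0 : 0 ≤ C)
    (hC : ∀ x, ‖f x‖ ≤ C) :
    (μ.withDensityᵥ g).integral f (ContinuousLinearMap.lsmul ℝ ℂ) = ∫ x, f x • g x ∂μ := by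
  have := isFiniteMeasure_variation_withDensityᵥ hg
  have hlim : ∀ x, Tendsto (fun n => hf.approxBounded C n x) atTop (𝓝 (f x)) := fun x =>
    hf.tendsto_approxBounded_of_norm_le (hC x)
  have hbd : ∀ n x, ‖hf.approxBounded C n x‖ ≤ C := hf.norm_approxBounded_le hC0
  have h1 : Tendsto (fun n => (μ.withDensityᵥ g).integral (hf.approxBounded C n)
      (ContinuousLinearMap.lsmul ℝ ℂ)) atTop
      (𝓝 ((μ.withDensityᵥ g).integral f (ContinuousLinearMap.lsmul ℝ ℂ))) :=
    VectorMeasure.tendsto_integral_of_dominated_convergence (fun _ => C)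
    (fun n => (hf.approxBounded C n).stronglyMeasurable.aestronglyMeasurable)
    (integrable_const C) (fun n => Eventually.of_forall (hbd n)) (Eventually.of_forall hlim)
  have h2 := tendsto_integral_of_dominated_convergence (μ := μ)
    (F := fun n x => hf.approxBounded C n x • g x) (f := fun x => f x • g x) (fun x => C * ‖g x‖)
    (fun n => (hf.approxBounded C n).stronglyMeasurable.aestronglyMeasurable.smul hg.1)
    (hg.norm.const_mul C)
    (fun n => Eventually.of_forall fun x => by
      rw [norm_smul]; gcongr; exact hbd n x)
    (Eventually.of_forall fun x => (hlim x).smul_const _)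
  refine tendsto_nhds_unique h1 (h2.congr fun n => ?_)
  exact (integral_withDensityᵥ_simpleFunc hg (hf.approxBounded C n)).symm

/-- The integral of a positively homogeneous function of a density only depends on the vector
measure that it defines. -/
theorem lintegral_eq_of_setIntegral_eq {μ₁ μ₂ : Measure X} [IsFiniteMeasure μ₁]
    [IsFiniteMeasure μ₂] {g₁ g₂ : X → E} (h₁ : Integrable g₁ μ₁) (h₂ : Integrable g₂ μ₂)
    (h : ∀ A, MeasurableSet A → ∫ x in A, g₁ x ∂μ₁ = ∫ x in A, g₂ x ∂μ₂)
    {N : X → E → ℝ≥0∞} (hN : ∀ x (c : ℝ) e, 0 ≤ c → N x (c • e) = ENNReal.ofReal c * N x e)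
    (hN₁ : AEMeasurable (fun x => N x (g₁ x)) μ₁) (hN₂ : AEMeasurable (fun x => N x (g₂ x)) μ₂) :
    ∫⁻ x, N x (g₁ x) ∂μ₁ = ∫⁻ x, N x (g₂ x) ∂μ₂ := by
  -- Both measures are absolutely continuous with respect to their sum; relative to it the two
  -- densities, multiplied by the Radon-Nikodym derivatives, have equal set integrals and so agree
  -- almost everywhere. Homogeneity of `N` absorbs the derivatives.
  set m := μ₁ + μ₂ with hm
  have ac₁ : μ₁ ≪ m := Measure.AbsolutelyContinuous.rfl.add_right _
  have ac₂ : μ₂ ≪ m := by rw [hm, add_comm]; exact Measure.AbsolutelyContinuous.rfl.add_right _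
  have key : ∀ {μ : Measure X} [IsFiniteMeasure μ] {g : X → E}, μ ≪ m →
      AEMeasurable (fun x => N x (g x)) μ →
      ∫⁻ x, N x (g x) ∂μ = ∫⁻ x, N x ((μ.rnDeriv m x).toReal • g x) ∂m := by
    intro μ _ g ac hm'
    have hw := Measure.withDensity_rnDeriv_eq μ m ac
    conv_lhs => rw [← hw]
    rw [lintegral_withDensity_eq_lintegral_mul₀' (Measure.measurable_rnDeriv μ m).aemeasurable
      (by rwa [hw])]
    refine lintegral_congr_ae ?_
    filter_upwards [Measure.rnDeriv_lt_top μ m] with x hx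
    rw [hN _ _ _ ENNReal.toReal_nonneg, ENNReal.ofReal_toReal hx.ne]
    rfl
  rw [key ac₁ hN₁, key ac₂ hN₂]
  have hae : (fun x => (μ₁.rnDeriv m x).toReal • g₁ x) =ᵐ[m]
      fun x => (μ₂.rnDeriv m x).toReal • g₂ x := by
    refine Integrable.ae_eq_of_forall_setIntegral_eq _ _ ((integrable_rnDeriv_smul_iff ac₁).2 h₁)
      ((integrable_rnDeriv_smul_iff ac₂).2 h₂) fun A hA _ => ?_
    rw [setIntegral_rnDeriv_smul ac₁ hA, setIntegral_rnDeriv_smul ac₂ hA, h A hA]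
  refine lintegral_congr_ae ?_
  filter_upwards [hae] with x hx
  rw [hx]

end Density

section Fourier

variable {E : Type*} [NormedAddCommGroup E] [NormedSpace ℂ E]

/-- Integration of continuous functions against a vector measure with density `g`. -/
def integralSmulCLM (μ : Measure Torus) {g : Torus → E} (hg : Integrable g μ) :
    C(Torus, ℂ) →L[ℂ] E :=
  have hi : ∀ f : C(Torus, ℂ), Integrable (fun x => f x • g x) μ := fun f =>
    hg.bdd_smul ‖f‖ f.continuous.aestronglyMeasurable (Eventually.of_forall f.norm_coe_le_norm)
  LinearMap.mkContinuous
    { toFun := fun f => ∫ x, f x • g x ∂μ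
      map_add' := fun f f' => by
        simp_rw [ContinuousMap.add_apply, add_smul]
        exact integral_add (hi f) (hi f')
      map_smul' := fun c f => by
        simp_rw [ContinuousMap.smul_apply, smul_assoc]
        exact integral_smul c _ } (∫ x, ‖g x‖ ∂μ) fun f => by
    refine (norm_integral_le_integral_norm _).trans ?_
    have h2 : ∫ x, ‖f x • g x‖ ∂μ ≤ ∫ x, ‖f‖ * ‖g x‖ ∂μ :=
      integral_mono (hi f).norm (hg.norm.const_mul _) fun x => by
        simp only [norm_smul]
        gcongr
        exact f.norm_coe_le_norm x
    rw [integral_const_mul] at h2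
    exact h2.trans_eq (mul_comm _ _)

/-- Both sides are continuous in f, and trigonometric polynomials are uniformly dense. -/
theorem integral_smul_eq_of_fourier {μ₁ μ₂ : Measure Torus} {g₁ g₂ : Torus → E}
    (h₁ : Integrable g₁ μ₁) (h₂ : Integrable g₂ μ₂)
    (h : ∀ n : ℤ, ∫ x, fourier n x • g₁ x ∂μ₁ = ∫ x, fourier n x • g₂ x ∂μ₂) (f : C(Torus, ℂ)) :
    ∫ x, f x • g₁ x ∂μ₁ = ∫ x, f x • g₂ x ∂μ₂ := by
  have : integralSmulCLM μ₁ h₁ = integralSmulCLM μ₂ h₂ := by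
    refine ContinuousLinearMap.ext_on (s := range (fourier (T := 2 * Real.pi))) ?_ ?_
    · rw [Submodule.dense_iff_topologicalClosure_eq_top]
      exact span_fourier_closure_eq_top
    · rintro _ ⟨n, rfl⟩
      exact h n
  exact congrArg (fun L : C(Torus, ℂ) →L[ℂ] E => L f) this

/-- Uniqueness of Fourier coefficients for vector measures: continuous functions decrease to
indicators of closed sets, and closed sets form a π-system generating the Borel sets. Two different
base measures are allowed because the intensity of W comes with an unspecified μ. -/
theorem setIntegral_eq_of_fourier {μ₁ μ₂ : Measure Torus} {g₁ g₂ : Torus → E}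
    (h₁ : Integrable g₁ μ₁) (h₂ : Integrable g₂ μ₂)
    (h : ∀ n : ℤ, ∫ x, fourier n x • g₁ x ∂μ₁ = ∫ x, fourier n x • g₂ x ∂μ₂)
    {A : Set Torus} (hA : MeasurableSet A) : ∫ x in A, g₁ x ∂μ₁ = ∫ x in A, g₂ x ∂μ₂ := by
  have hcl : ∀ F : Set Torus, IsClosed F → ∫ x in F, g₁ x ∂μ₁ = ∫ x in F, g₂ x ∂μ₂ := by
    intro F hF
    have hδ0 : ∀ n : ℕ, (0 : ℝ) < 1 / ((n : ℝ) + 1) := fun n => by positivity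
    have ht := thickenedIndicator_tendsto_indicator_closure hδ0
      tendsto_one_div_add_atTop_nhds_zero_nat F
    rw [hF.closure_eq, tendsto_pi_nhds] at ht
    have hlim : ∀ {μ : Measure Torus} {g : Torus → E}, Integrable g μ →
        Tendsto (fun n => ∫ x, ((thickenedIndicator (hδ0 n) F x : ℝ) : ℂ) • g x ∂μ) atTop
          (𝓝 (∫ x in F, g x ∂μ)) := by
      intro μ g hg
      rw [← integral_indicator hF.measurableSet]
      refine tendsto_integral_of_dominated_convergence (fun x => ‖g x‖) (fun n => ?_) hg.norm
        (fun n => Eventually.of_forall fun x => ?_) (Eventually.of_forall fun x => ?_)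
      · refine AEStronglyMeasurable.smul ?_ hg.1
        exact (Complex.continuous_ofReal.comp (NNReal.continuous_coe.comp
          (thickenedIndicator (hδ0 n) F).continuous)).aestronglyMeasurable
      · rw [norm_smul]
        refine mul_le_of_le_one_left (norm_nonneg _) ?_
        simpa using! thickenedIndicator_le_one (hδ0 n) F x
      · have h3 : Tendsto (fun n => ((thickenedIndicator (hδ0 n) F x : ℝ) : ℂ)) atTop
            (𝓝 (((F.indicator (fun _ => (1 : NNReal)) x : NNReal) : ℝ) : ℂ)) :=
          ((Complex.continuous_ofReal.comp NNReal.continuous_coe).tendsto _).comp (ht x)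
        have h4 := h3.smul_const (g x)
        by_cases hx : x ∈ F <;> simpa [hx] using! h4
    refine tendsto_nhds_unique (hlim h₁) ((hlim h₂).congr fun n => ?_)
    exact (integral_smul_eq_of_fourier h₁ h₂ h
      ⟨fun x => ((thickenedIndicator (hδ0 n) F x : ℝ) : ℂ), Complex.continuous_ofReal.comp
        (NNReal.continuous_coe.comp (thickenedIndicator (hδ0 n) F).continuous)⟩).symm
  have : μ₁.withDensityᵥ g₁ = μ₂.withDensityᵥ g₂ := by
    refine VectorMeasure.ext_of_generateFrom {F | IsClosed F} (fun F hF => ?_)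
      ((BorelSpace.measurable_eq (α := Torus)).trans borel_eq_generateFrom_isClosed) isPiSystem_isClosed ?_
    · rw [withDensityᵥ_apply h₁ (IsClosed.measurableSet hF),
        withDensityᵥ_apply h₂ (IsClosed.measurableSet hF)]
      exact hcl F hF
    · rw [withDensityᵥ_apply h₁ MeasurableSet.univ, withDensityᵥ_apply h₂ MeasurableSet.univ]
      exact hcl _ isClosed_univ
  rw [← withDensityᵥ_apply h₁ hA, ← withDensityᵥ_apply h₂ hA, this]

end Fourier

/-! ### Second moments of Hilbert-valued random variables -/

section SecondMoment

set_option linter.unusedSectionVars false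

variable {H : Type*} [NormedAddCommGroup H] [InnerProductSpace ℂ H] [CompleteSpace H]
variable {Ω : Type*} [MeasurableSpace Ω] {P : Measure Ω}

/-- The second moment operator `E[X Yᴴ]`. -/
def secondMoment (X Y : Lp H 2 P) : H →L[ℂ] H :=
  ∫ ω, InnerProductSpace.rankOne ℂ (X ω) (Y ω) ∂P

theorem crossCov_eq_secondMoment {X Y : Lp H 2 P} (hX : ∫ ω, X ω ∂P = 0) (hY : ∫ ω, Y ω ∂P = 0) :
    crossCov P X Y = secondMoment X Y := by
  simp [crossCov, secondMoment, hX, hY]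

theorem aestronglyMeasurable_rankOne (X Y : Lp H 2 P) :
    AEStronglyMeasurable (fun ω => InnerProductSpace.rankOne ℂ (X ω) (Y ω)) P := by
  -- Real scalars, because the rank-one operator is conjugate-linear in its second vector.
  have h : IsBoundedBilinearMap ℝ fun p : H × H => InnerProductSpace.rankOne ℂ p.1 p.2 :=
    { add_left := fun x x' y => by rw [map_add, add_apply]
      smul_left := fun c x y => by
        ext v
        simp only [InnerProductSpace.rankOne_apply, smul_apply]
        exact smul_comm _ _ _
      add_right := fun x y y' => map_add _ _ _
      smul_right := fun c x y => by
        ext v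
        simp only [InnerProductSpace.rankOne_apply, smul_apply]
        rw [← Complex.coe_smul c y, inner_smul_left, Complex.conj_ofReal, mul_smul,
          Complex.coe_smul]
      bound := ⟨1, one_pos, fun x y => by simp⟩ }
  have hc : Continuous fun p : H × H => InnerProductSpace.rankOne ℂ p.1 p.2 := h.continuous
  exact Continuous.comp_aestronglyMeasurable₂ (g := fun x y : H => InnerProductSpace.rankOne ℂ x y)
    hc (Lp.aestronglyMeasurable X) (Lp.aestronglyMeasurable Y)

/-- Since ‖x yᴴ‖ = ‖x‖ ‖y‖, this is Cauchy-Schwarz in L². -/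
theorem lintegral_enorm_rankOne_le (X Y : Lp H 2 P) :
    ∫⁻ ω, ‖InnerProductSpace.rankOne ℂ (X ω) (Y ω)‖ₑ ∂P ≤ ‖X‖ₑ * ‖Y‖ₑ := by
  simp_rw [InnerProductSpace.enorm_rankOne]
  have hn : ∀ Z : Lp H 2 P, ‖Z‖ₑ = (∫⁻ ω, ‖Z ω‖ₑ ^ (2 : ℝ) ∂P) ^ (1 / 2 : ℝ) := fun Z => by
    rw [Lp.enorm_def, eLpNorm_eq_lintegral_rpow_enorm_toReal (by norm_num) (by norm_num)]
    norm_num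
  rw [hn, hn]
  exact ENNReal.lintegral_mul_le_Lp_mul_Lq P Real.HolderConjugate.two_two
    (Lp.aestronglyMeasurable X).enorm (Lp.aestronglyMeasurable Y).enorm

theorem integrable_rankOne (X Y : Lp H 2 P) :
    Integrable (fun ω => InnerProductSpace.rankOne ℂ (X ω) (Y ω)) P :=
  ⟨aestronglyMeasurable_rankOne X Y, (lintegral_enorm_rankOne_le X Y).trans_lt
    (ENNReal.mul_lt_top enorm_lt_top enorm_lt_top)⟩

theorem secondMoment_add_left (X X' Y : Lp H 2 P) :
    secondMoment (X + X') Y = secondMoment X Y + secondMoment X' Y := by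
  unfold secondMoment
  rw [← integral_add (integrable_rankOne X Y) (integrable_rankOne X' Y)]
  refine integral_congr_ae ?_
  filter_upwards [Lp.coeFn_add X X'] with ω h
  rw [h, Pi.add_apply, map_add, add_apply]

theorem secondMoment_add_right (X Y Y' : Lp H 2 P) :
    secondMoment X (Y + Y') = secondMoment X Y + secondMoment X Y' := by
  unfold secondMoment
  rw [← integral_add (integrable_rankOne X Y) (integrable_rankOne X Y')]
  refine integral_congr_ae ?_
  filter_upwards [Lp.coeFn_add Y Y'] with ω h
  rw [h, Pi.add_apply, map_add]

theorem secondMoment_smul_left (c : ℝ) (X Y : Lp H 2 P) :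
    secondMoment (c • X) Y = c • secondMoment X Y := by
  unfold secondMoment
  rw [← integral_smul]
  refine integral_congr_ae ?_
  filter_upwards [Lp.coeFn_smul c X] with ω h
  ext v
  simp only [h, Pi.smul_apply, InnerProductSpace.rankOne_apply, smul_apply]
  exact smul_comm _ _ _

theorem secondMoment_smul_right (c : ℝ) (X Y : Lp H 2 P) :
    secondMoment X (c • Y) = c • secondMoment X Y := by
  unfold secondMoment
  rw [← integral_smul]
  refine integral_congr_ae ?_
  filter_upwards [Lp.coeFn_smul c Y] with ω h
  ext v
  simp only [h, Pi.smul_apply, InnerProductSpace.rankOne_apply, smul_apply]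
  rw [← Complex.coe_smul c (Y ω), inner_smul_left, Complex.conj_ofReal, mul_smul, Complex.coe_smul]

theorem enorm_secondMoment_le (X Y : Lp H 2 P) : ‖secondMoment X Y‖ₑ ≤ ‖X‖ₑ * ‖Y‖ₑ :=
  (enorm_integral_le_lintegral_enorm _).trans (lintegral_enorm_rankOne_le X Y)

theorem continuous_secondMoment :
    Continuous fun p : Lp H 2 P × Lp H 2 P => secondMoment p.1 p.2 := by
  have : IsBoundedBilinearMap ℝ fun p : Lp H 2 P × Lp H 2 P => secondMoment p.1 p.2 :=
    { add_left := secondMoment_add_left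
      smul_left := secondMoment_smul_left
      add_right := secondMoment_add_right
      smul_right := secondMoment_smul_right
      bound := ⟨1, one_pos, fun X Y => by
        have h := enorm_secondMoment_le X Y
        simp only [← ofReal_norm, ← ENNReal.ofReal_mul (norm_nonneg _)] at h
        rwa [ENNReal.ofReal_le_ofReal_iff (by positivity), ← one_mul ‖X‖] at h⟩ }
  exact this.continuous

theorem secondMoment_zero_left (Y : Lp H 2 P) : secondMoment 0 Y = 0 := by
  simpa using secondMoment_smul_left 0 0 Y

theorem secondMoment_zero_right (X : Lp H 2 P) : secondMoment X 0 = 0 := by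
  simpa using secondMoment_smul_right 0 X 0

theorem secondMoment_sum_left {ι : Type*} (s : Finset ι) (X : ι → Lp H 2 P) (Y : Lp H 2 P) :
    secondMoment (∑ i ∈ s, X i) Y = ∑ i ∈ s, secondMoment (X i) Y := by
  classical
  induction s using Finset.induction_on with
  | empty => simp [secondMoment_zero_left]
  | insert i s hi ih => rw [Finset.sum_insert hi, Finset.sum_insert hi, secondMoment_add_left, ih]

theorem secondMoment_sum_right {ι : Type*} (s : Finset ι) (X : Lp H 2 P) (Y : ι → Lp H 2 P) :
    secondMoment X (∑ i ∈ s, Y i) = ∑ i ∈ s, secondMoment X (Y i) := by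
  classical
  induction s using Finset.induction_on with
  | empty => simp [secondMoment_zero_right]
  | insert i s hi ih => rw [Finset.sum_insert hi, Finset.sum_insert hi, secondMoment_add_right, ih]

theorem secondMoment_compLp (A B : H →L[ℂ] H) (X Y : Lp H 2 P) :
    secondMoment (A.compLp X) (B.compLp Y) = A * secondMoment X Y * B.adjoint := by
  unfold secondMoment
  rw [← integral_const_mul_of_integrable (integrable_rankOne X Y),
    ← integral_mul_const_of_integrable ((integrable_rankOne X Y).const_mul A)]
  refine integral_congr_ae ?_
  filter_upwards [A.coeFn_compLp X, B.coeFn_compLp Y] with ω h h'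
  ext v
  simp [h, h', ContinuousLinearMap.adjoint_inner_right]

variable [IsProbabilityMeasure P]

theorem integrable_coeFn (X : Lp H 2 P) : Integrable X P :=
  (Lp.memLp X).integrable (by norm_num)

/-- On a probability space L² convergence implies L¹ convergence, hence convergence of means. -/
theorem integral_eq_zero_of_tendsto {X : ℕ → Lp H 2 P} {Y : Lp H 2 P}
    (hX : ∀ n, ∫ ω, X n ω ∂P = 0) (h : Tendsto X atTop (𝓝 Y)) : ∫ ω, Y ω ∂P = 0 := by
  rw [Lp.tendsto_Lp_iff_tendsto_eLpNorm'] at h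
  have h1 : Tendsto (fun n => eLpNorm (X n - Y : Ω → H) 1 P) atTop (𝓝 0) :=
    tendsto_of_tendsto_of_tendsto_of_le_of_le tendsto_const_nhds h (fun _ => zero_le) fun n =>
      eLpNorm_le_eLpNorm_of_exponent_le (by norm_num)
        ((Lp.aestronglyMeasurable _).sub (Lp.aestronglyMeasurable _))
  have h2 := tendsto_integral_of_L1' (Y : Ω → H) (Lp.aestronglyMeasurable Y)
    (Eventually.of_forall fun n => integrable_coeFn (X n)) h1
  simp_rw [hX] at h2
  exact (tendsto_nhds_unique h2 tendsto_const_nhds)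

theorem integral_simpleOpIntegral {W : VectorMeasure Torus (Lp H 2 P)} (hW : IsCAGOS P W)
    (S : SimpleFunc Torus (H →L[ℂ] H)) : ∫ ω, simpleOpIntegral W S ω ∂P = 0 := by
  have h1 : ∀ T : H →L[ℂ] H, ∫ ω, T.compLp (W (S ⁻¹' {T})) ω ∂P = 0 := fun T => by
    rw [integral_congr_ae (T.coeFn_compLp' _), T.integral_comp_comm (integrable_coeFn _),
      hW.centered _ (S.measurableSet_fiber T), map_zero]
  have h2 : ∀ s : Finset (H →L[ℂ] H), ∫ ω, (∑ T ∈ s, T.compLp (W (S ⁻¹' {T})) : Lp H 2 P) ω ∂P = 0 := by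
    classical
    intro s
    induction s using Finset.induction_on with
    | empty =>
      rw [Finset.sum_empty, integral_congr_ae (Lp.coeFn_zero H 2 P)]
      simp
    | insert i s hi ih =>
      rw [Finset.sum_insert hi, integral_congr_ae (Lp.coeFn_add _ _)]
      simp only [Pi.add_apply]
      rw [integral_add (integrable_coeFn _) (integrable_coeFn _), ih, h1, add_zero]
  exact h2 _

/-- Splitting A and B along A ∩ B, every cross term involves disjoint sets and vanishes. -/
theorem IsCAGOS.secondMoment_inter {W : VectorMeasure Torus (Lp H 2 P)} (hW : IsCAGOS P W)
    {A B : Set Torus} (hA : MeasurableSet A) (hB : MeasurableSet B) :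
    secondMoment (W A) (W B) = crossCov P (W (A ∩ B)) (W (A ∩ B)) := by
  have h0 : ∀ {A B : Set Torus}, MeasurableSet A → MeasurableSet B → Disjoint A B →
      secondMoment (W A) (W B) = 0 := fun hA hB h => by
    rw [← crossCov_eq_secondMoment (hW.centered _ hA) (hW.centered _ hB)]
    exact hW.orthogonal _ _ hA hB h
  have hi := hA.inter hB
  rw [crossCov_eq_secondMoment (hW.centered _ hi) (hW.centered _ hi)]
  have e1 : W A = W (A ∩ B) + W (A \ B) := by
    rw [← VectorMeasure.of_union (disjoint_sdiff_inter.symm) hi (hA.diff hB), inter_union_sdiff]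
  have e2 : W B = W (A ∩ B) + W (B \ A) := by
    rw [inter_comm A B, ← VectorMeasure.of_union (disjoint_sdiff_inter.symm) (hB.inter hA) (hB.diff hA),
      inter_union_sdiff]
  have d1 : Disjoint (A \ B) B := disjoint_sdiff_left
  have d2 : Disjoint (A ∩ B) (B \ A) :=
    disjoint_left.2 fun _ h h' => h'.2 h.1
  conv_lhs => rw [e1, secondMoment_add_left, h0 (hA.diff hB) hB d1, add_zero, e2,
    secondMoment_add_right, h0 hi (hB.diff hA) d2, add_zero]

end SecondMoment

/-! ### Operator-valued integrals with respect to a c.a.g.o.s. measure -/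

section Isometry

set_option linter.unusedSectionVars false

variable {H : Type*} [NormedAddCommGroup H] [InnerProductSpace ℂ H] [CompleteSpace H]

theorem IsOperatorDensity.integrable {ν : Set Torus → H →L[ℂ] H} {μ : Measure Torus}
    {g : Torus → H →L[ℂ] H} (h : IsOperatorDensity ν μ g) : Integrable g μ := by
  refine ⟨h.aestronglyMeasurable, lt_of_le_of_lt (lintegral_mono_ae ?_) h.lintegral_trace_lt_top⟩
  filter_upwards [h.isPositive] with x hx
  exact enorm_le_posTrace hx

theorem continuous_adjoint : Continuous fun A : H →L[ℂ] H => A.adjoint :=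
  (ContinuousLinearMap.adjoint (𝕜 := ℂ) (E := H) (F := H)).continuous

theorem aestronglyMeasurable_sandwich {μ : Measure Torus} {g A B : Torus → H →L[ℂ] H}
    (hA : AEStronglyMeasurable A μ) (hg : AEStronglyMeasurable g μ)
    (hB : AEStronglyMeasurable B μ) :
    AEStronglyMeasurable (fun x => A x * g x * (B x).adjoint) μ :=
  (hA.mul hg).mul (continuous_adjoint.comp_aestronglyMeasurable hB)

/-- The integrated form of `enorm_sandwich_le`, by Hölder's inequality with exponents 2 and 2. -/
theorem lintegral_sandwich_le {μ : Measure Torus} {g A B : Torus → H →L[ℂ] H}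
    (hg : AEStronglyMeasurable g μ) (hpos : ∀ᵐ x ∂μ, (g x).IsPositive)
    (hA : AEStronglyMeasurable A μ) (hB : AEStronglyMeasurable B μ) :
    ∫⁻ x, ‖A x * g x * (B x).adjoint‖ₑ ∂μ ≤
      (∫⁻ x, ‖A x * g x * (A x).adjoint‖ₑ ∂μ) ^ (1 / 2 : ℝ) *
      (∫⁻ x, ‖B x * g x * (B x).adjoint‖ₑ ∂μ) ^ (1 / 2 : ℝ) := by
  have h := ENNReal.lintegral_mul_le_Lp_mul_Lq μ Real.HolderConjugate.two_two
    (f := fun x => ‖A x * g x * (A x).adjoint‖ₑ ^ (1 / 2 : ℝ))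
    (g := fun x => ‖B x * g x * (B x).adjoint‖ₑ ^ (1 / 2 : ℝ))
    ((aestronglyMeasurable_sandwich hA hg hA).enorm.pow_const _)
    ((aestronglyMeasurable_sandwich hB hg hB).enorm.pow_const _)
  simp only [← ENNReal.rpow_mul, one_div, ne_eq, OfNat.ofNat_ne_zero, not_false_eq_true,
    inv_mul_cancel₀, ENNReal.rpow_one] at h ⊢
  refine (lintegral_mono_ae ?_).trans h
  filter_upwards [hpos] with x hx
  simpa using enorm_sandwich_le hx (A x) (B x)

/-- Continuity of the form (Φ, Ψ) ↦ ∫ Φ g Ψᴴ dμ for the seminorm given by its diagonal. -/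
theorem tendsto_integral_sandwich {μ : Measure Torus} {g Φ Ψ : Torus → H →L[ℂ] H}
    (hg : Integrable g μ) (hpos : ∀ᵐ x ∂μ, (g x).IsPositive)
    (hΦ : Continuous Φ) (hΨ : Continuous Ψ) {S T : ℕ → SimpleFunc Torus (H →L[ℂ] H)}
    (hS : Tendsto (fun n => ∫⁻ x, ‖(S n x - Φ x) * g x * (S n x - Φ x).adjoint‖ₑ ∂μ) atTop (𝓝 0))
    (hT : Tendsto (fun n => ∫⁻ x, ‖(T n x - Ψ x) * g x * (T n x - Ψ x).adjoint‖ₑ ∂μ) atTop (𝓝 0)) :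
    Tendsto (fun n => ∫ x, S n x * g x * (T n x).adjoint ∂μ) atTop
      (𝓝 (∫ x, Φ x * g x * (Ψ x).adjoint ∂μ)) := by
  have hmΦ : AEStronglyMeasurable Φ μ := hΦ.aestronglyMeasurable
  have hmΨ : AEStronglyMeasurable Ψ μ := hΨ.aestronglyMeasurable
  have hmS : ∀ n, AEStronglyMeasurable (S n) μ := fun n => (S n).stronglyMeasurable.aestronglyMeasurable
  have hmT : ∀ n, AEStronglyMeasurable (T n) μ := fun n => (T n).stronglyMeasurable.aestronglyMeasurable
  have hfin : ∀ {A B : Torus → H →L[ℂ] H}, AEStronglyMeasurable A μ → AEStronglyMeasurable B μ →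
      (∃ C, ∀ x, ‖A x‖ ≤ C) → (∃ C, ∀ x, ‖B x‖ ≤ C) →
      Integrable (fun x => A x * g x * (B x).adjoint) μ := by
    rintro A B hA hB ⟨C, hC⟩ ⟨D, hD⟩
    refine Integrable.mono' (hg.norm.const_mul (C * D)) (aestronglyMeasurable_sandwich hA hg.1 hB)
      (Eventually.of_forall fun x => ?_)
    have hC0 : 0 ≤ C := (norm_nonneg _).trans (hC x)
    calc ‖A x * g x * (B x).adjoint‖ ≤ ‖A x‖ * ‖g x‖ * ‖(B x).adjoint‖ := norm_mul₃_le
      _ ≤ C * ‖g x‖ * D := by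
        gcongr
        · exact hC x
        · simpa using hD x
      _ = C * D * ‖g x‖ := by ring
  have hbd : ∀ {F : Torus → H →L[ℂ] H}, Continuous F → ∃ C, ∀ x, ‖F x‖ ≤ C := fun hF => by
    obtain ⟨C, hC⟩ := isCompact_univ.exists_bound_of_continuousOn hF.continuousOn
    exact ⟨C, fun x => hC x (mem_univ x)⟩
  have hiΦ := hfin hmΦ hmΦ (hbd hΦ) (hbd hΦ)
  have hiΨ := hfin hmΨ hmΨ (hbd hΨ) (hbd hΨ)
  rw [tendsto_iff_edist_tendsto_0]
  have hr : ∀ {u : ℕ → ℝ≥0∞}, Tendsto u atTop (𝓝 0) → Tendsto (fun n => u n ^ (1 / 2 : ℝ)) atTop (𝓝 0) :=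
    fun hu => by simpa using hu.ennrpow_const (1 / 2 : ℝ)
  have hup := ((ENNReal.Tendsto.mul (hr hS) (Or.inr ENNReal.zero_ne_top) (hr hT)
    (Or.inr ENNReal.zero_ne_top)).add
    (ENNReal.Tendsto.mul_const (b := (∫⁻ x, ‖Ψ x * g x * (Ψ x).adjoint‖ₑ ∂μ) ^ (1 / 2 : ℝ)) (hr hS)
      (Or.inr (ENNReal.rpow_ne_top_of_nonneg (by norm_num) hiΨ.2.ne)))).add
    (ENNReal.Tendsto.const_mul (a := (∫⁻ x, ‖Φ x * g x * (Φ x).adjoint‖ₑ ∂μ) ^ (1 / 2 : ℝ)) (hr hT)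
      (Or.inr (ENNReal.rpow_ne_top_of_nonneg (by norm_num) hiΦ.2.ne)))
  simp only [mul_zero, zero_mul, add_zero] at hup
  refine tendsto_of_tendsto_of_tendsto_of_le_of_le tendsto_const_nhds hup (fun _ => zero_le)
    fun n => ?_
  have h1 := hfin (hmS n) (hmT n) (S n).exists_forall_norm_le (T n).exists_forall_norm_le
  have h2 := hfin hmΦ hmΨ (hbd hΦ) (hbd hΨ)
  rw [edist_eq_enorm_sub, ← integral_sub h1 h2]
  have hdS := (hmS n).sub hmΦ
  have hdT := (hmT n).sub hmΨ
  calc _ ≤ ∫⁻ x, ‖S n x * g x * (T n x).adjoint - Φ x * g x * (Ψ x).adjoint‖ₑ ∂μ :=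
        enorm_integral_le_lintegral_enorm _
    _ ≤ ∫⁻ x, (‖(S n x - Φ x) * g x * (T n x - Ψ x).adjoint‖ₑ
          + ‖(S n x - Φ x) * g x * (Ψ x).adjoint‖ₑ) + ‖Φ x * g x * (T n x - Ψ x).adjoint‖ₑ ∂μ := by
        refine lintegral_mono fun x => ?_
        -- Each of the three terms contains at least one difference, so Cauchy-Schwarz makes it tend
        -- to 0.
        have : S n x * g x * (T n x).adjoint - Φ x * g x * (Ψ x).adjoint =
          (S n x - Φ x) * g x * (T n x - Ψ x).adjoint + (S n x - Φ x) * g x * (Ψ x).adjoint +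
            Φ x * g x * (T n x - Ψ x).adjoint := by
          rw [map_sub]; noncomm_ring
        rw [this]
        exact (enorm_add_le _ _).trans (by gcongr; exact enorm_add_le _ _)
    _ = _ := by
        rw [lintegral_add_left', lintegral_add_left']
        · exact (aestronglyMeasurable_sandwich hdS hg.1 hdT).enorm
        · exact (aestronglyMeasurable_sandwich hdS hg.1 hdT).enorm.add
            (aestronglyMeasurable_sandwich hdS hg.1 hmΨ).enorm
    _ ≤ _ := by
        gcongr
        · exact lintegral_sandwich_le hg.1 hpos hdS hdT
        · exact lintegral_sandwich_le hg.1 hpos hdS hmΨ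
        · exact lintegral_sandwich_le hg.1 hpos hmΦ hdT

theorem integral_simpleFunc_sandwich {μ : Measure Torus} {g : Torus → H →L[ℂ] H}
    (hg : Integrable g μ) (S T : SimpleFunc Torus (H →L[ℂ] H)) :
    ∫ x, S x * g x * (T x).adjoint ∂μ =
      ∑ A ∈ S.range, ∑ B ∈ T.range, A * (∫ x in S ⁻¹' {A} ∩ T ⁻¹' {B}, g x ∂μ) * B.adjoint := by
  classical
  have hm : ∀ A B, MeasurableSet (S ⁻¹' {A} ∩ T ⁻¹' {B}) := fun A B =>
    (S.measurableSet_fiber A).inter (T.measurableSet_fiber B)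
  have hi : ∀ A B, Integrable (fun x => A * (S ⁻¹' {A} ∩ T ⁻¹' {B}).indicator g x * B.adjoint) μ :=
    fun A B => ((hg.indicator (hm A B)).const_mul A).mul_const _
  have h1 : ∀ x, S x * g x * (T x).adjoint = ∑ A ∈ S.range, ∑ B ∈ T.range,
      A * (S ⁻¹' {A} ∩ T ⁻¹' {B}).indicator g x * B.adjoint := fun x => by
    rw [Finset.sum_eq_single (S x), Finset.sum_eq_single (T x)]
    · simp
    · intro B _ hB
      rw [indicator_of_notMem (fun h => hB h.2.symm)]; simp
    · exact fun h => (h (T.mem_range_self x)).elim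
    · intro A _ hA
      refine Finset.sum_eq_zero fun B _ => ?_
      rw [indicator_of_notMem (fun h => hA h.1.symm)]; simp
    · exact fun h => (h (S.mem_range_self x)).elim
  simp_rw [h1]
  rw [integral_finsetSum _ fun A _ => integrable_finsetSum _ fun B _ => hi A B]
  refine Finset.sum_congr rfl fun A _ => ?_
  rw [integral_finsetSum _ fun B _ => hi A B]
  refine Finset.sum_congr rfl fun B _ => ?_
  rw [integral_mul_const_of_integrable ((hg.indicator (hm A B)).const_mul A),
    integral_const_mul_of_integrable (hg.indicator (hm A B)), integral_indicator (hm A B)]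

variable {Ω : Type*} [MeasurableSpace Ω] {P : Measure Ω} [IsProbabilityMeasure P]

/-- The isometry for simple functions: on both sides the pair of values (A, B) is weighted by the
intensity of the intersection of the two fibres. -/
theorem secondMoment_simpleOpIntegral {W : VectorMeasure Torus (Lp H 2 P)} (hW : IsCAGOS P W)
    {μ : Measure Torus} {g : Torus → H →L[ℂ] H}
    (hg : IsOperatorDensity (fun A => crossCov P (W A) (W A)) μ g)
    (S T : SimpleFunc Torus (H →L[ℂ] H)) :
    secondMoment (simpleOpIntegral W S) (simpleOpIntegral W T) =
      ∫ x, S x * g x * (T x).adjoint ∂μ := by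
  rw [integral_simpleFunc_sandwich hg.integrable, simpleOpIntegral, secondMoment_sum_left]
  refine Finset.sum_congr rfl fun A _ => ?_
  rw [simpleOpIntegral, secondMoment_sum_right]
  refine Finset.sum_congr rfl fun B _ => ?_
  rw [secondMoment_compLp, hW.secondMoment_inter (S.measurableSet_fiber A) (T.measurableSet_fiber B)]
  rw [← hg.eq_integral _ ((S.measurableSet_fiber A).inter (T.measurableSet_fiber B))]

/-- The approximation property defining `Y = ∫ Φ dW`, relative to a given density `g` of the
intensity measure of `W` with respect to `μ`. -/
def IsOpLimit (W : VectorMeasure Torus (Lp H 2 P)) (μ : Measure Torus) (g Φ : Torus → H →L[ℂ] H)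
    (Y : Lp H 2 P) : Prop :=
  ∃ S : ℕ → SimpleFunc Torus (H →L[ℂ] H),
    Tendsto (fun n => ∫⁻ x, ‖(S n x - Φ x) * g x * (S n x - Φ x).adjoint‖ₑ ∂μ) atTop (𝓝 0) ∧
    Tendsto (fun n => simpleOpIntegral W (S n)) atTop (𝓝 Y)

/-- Each `HasOpIntegral` carries its own pair (μ', g'); this moves the approximation to one
prescribed pair, so that integrals with different pairs can be compared. Bounding the trace below by
the operator norm loses nothing needed: the norm suffices for the isometry, and its measurability is
immediate. -/
theorem HasOpIntegral.isOpLimit {W : VectorMeasure Torus (Lp H 2 P)} {Φ : Torus → H →L[ℂ] H}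
    {Y : Lp H 2 P} (h : HasOpIntegral W Φ Y) (hΦ : Continuous Φ)
    {μ : Measure Torus} [IsFiniteMeasure μ] {g : Torus → H →L[ℂ] H} (hgi : Integrable g μ)
    (hg : ∀ A, MeasurableSet A → crossCov P (W A) (W A) = ∫ x in A, g x ∂μ) :
    IsOpLimit W μ g Φ Y := by
  obtain ⟨-, μ', g', hμ', hg', S, hS, hY⟩ := h
  refine ⟨S, ?_, hY⟩
  refine tendsto_of_tendsto_of_tendsto_of_le_of_le tendsto_const_nhds hS (fun _ => zero_le)
    fun n => ?_
  have hD : ∀ m : Measure Torus, AEStronglyMeasurable (fun x => S n x - Φ x) m := fun m =>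
    (S n).stronglyMeasurable.aestronglyMeasurable.sub hΦ.aestronglyMeasurable
  calc ∫⁻ x, ‖(S n x - Φ x) * g x * (S n x - Φ x).adjoint‖ₑ ∂μ
      = ∫⁻ x, ‖(S n x - Φ x) * g' x * (S n x - Φ x).adjoint‖ₑ ∂μ' := by
        refine lintegral_eq_of_setIntegral_eq
          (N := fun x e => ‖(S n x - Φ x) * e * (S n x - Φ x).adjoint‖ₑ) hgi hg'.integrable
          (fun A hA => ?_) (fun x c e hc => ?_) ?_ ?_
        · rw [← hg A hA, ← hg'.eq_integral A hA]
        · rw [mul_smul_comm, smul_mul_assoc, enorm_smul, Real.enorm_of_nonneg hc]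
        · exact (aestronglyMeasurable_sandwich (hD _) hgi.1 (hD _)).enorm
        · exact (aestronglyMeasurable_sandwich (hD _) hg'.aestronglyMeasurable (hD _)).enorm
    _ ≤ _ := by
        refine lintegral_mono_ae ?_
        filter_upwards [hg'.isPositive] with x hx
        exact enorm_le_posTrace (isPositive_sandwich hx _)

theorem HasOpIntegral.integral_eq_zero {W : VectorMeasure Torus (Lp H 2 P)} (hW : IsCAGOS P W)
    {Φ : Torus → H →L[ℂ] H} {Y : Lp H 2 P} (h : HasOpIntegral W Φ Y) : ∫ ω, Y ω ∂P = 0 := by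
  obtain ⟨-, -, -, -, -, S, -, hY⟩ := h
  exact integral_eq_zero_of_tendsto (fun n => integral_simpleOpIntegral hW (S n)) hY

/-- The gramian isometry. -/
theorem secondMoment_eq_integral {W : VectorMeasure Torus (Lp H 2 P)} (hW : IsCAGOS P W)
    {μ : Measure Torus} {g : Torus → H →L[ℂ] H}
    (hg : IsOperatorDensity (fun A => crossCov P (W A) (W A)) μ g)
    {Φ Ψ : Torus → H →L[ℂ] H} (hΦ : Continuous Φ) (hΨ : Continuous Ψ) {Y Y' : Lp H 2 P}
    (hY : IsOpLimit W μ g Φ Y) (hY' : IsOpLimit W μ g Ψ Y') :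
    secondMoment Y Y' = ∫ x, Φ x * g x * (Ψ x).adjoint ∂μ := by
  obtain ⟨S, hS, hSY⟩ := hY
  obtain ⟨T, hT, hTY⟩ := hY'
  have h1 := (continuous_secondMoment.tendsto (Y, Y')).comp (hSY.prodMk_nhds hTY)
  refine tendsto_nhds_unique h1
    ((tendsto_integral_sandwich hg.integrable hg.isPositive hΦ hΨ hS hT).congr fun n => ?_)
  exact (secondMoment_simpleOpIntegral hW hg (S n) (T n)).symm

end Isometry

/-! ### Spectral density of a filtered white noise -/

section SpectralDensity

set_option linter.unusedSectionVars false

variable {H : Type*} [NormedAddCommGroup H] [InnerProductSpace ℂ H] [CompleteSpace H]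
variable {Ω : Type*} [MeasurableSpace Ω] {P : Measure Ω}

theorem autocov_eq_integral {X : ℤ → Lp H 2 P} {ν : VectorMeasure Torus (H →L[ℂ] H)}
    (hν : IsSpectralOperatorMeasure P X ν) {μ : Measure Torus} {g : Torus → H →L[ℂ] H}
    (hg : IsOperatorDensity ν μ g) (n : ℤ) :
    crossCov P (X n) (X 0) = ∫ x, (fourier n x : ℂ) • g x ∂μ := by
  have h1 : ν = μ.withDensityᵥ g := by
    ext A hA : 1
    rw [withDensityᵥ_apply hg.integrable hA, hg.eq_integral A hA]
  rw [hν.autocov n, h1]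
  exact integral_withDensityᵥ hg.integrable (fourier n).continuous.stronglyMeasurable zero_le_one
    fun x => (Circle.norm_coe _).le

theorem IsSpectralDensity.ae_eq {X : ℤ → Lp H 2 P} {g g' : Torus → H →L[ℂ] H}
    (h : IsSpectralDensity P X g) (h' : IsSpectralDensity P X g') :
    g =ᵐ[AddCircle.haarAddCircle] g' := by
  obtain ⟨ν, hν, hg⟩ := h
  obtain ⟨ν', hν', hg'⟩ := h'
  refine Integrable.ae_eq_of_forall_setIntegral_eq _ _ hg.integrable hg'.integrable fun A hA _ => ?_
  refine setIntegral_eq_of_fourier hg.integrable hg'.integrable (fun n => ?_) hA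
  rw [← autocov_eq_integral hν hg, ← autocov_eq_integral hν' hg']

/-- The normalised measure has mass 1, so lag 0 identifies the constant density with Cov(Z₀, Z₀). -/
theorem IsWhiteNoise.exists_density {Z : ℤ → Lp H 2 P} (hZ : IsWhiteNoise P Z) :
    (crossCov P (Z 0) (Z 0)).IsPositive ∧ posTrace (crossCov P (Z 0) (Z 0)) < ∞ ∧
      ∀ n : ℤ, crossCov P (Z n) (Z 0) =
        ∫ x : Torus, (fourier n x : ℂ) • crossCov P (Z 0) (Z 0) ∂AddCircle.haarAddCircle := by
  obtain ⟨S, ν, hν, hg⟩ := hZ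
  have h0 := autocov_eq_integral hν hg
  have hS : crossCov P (Z 0) (Z 0) = S := by
    rw [h0 0]; simp
  rw [hS]
  refine ⟨?_, ?_, h0⟩
  · obtain ⟨x, hx⟩ := hg.isPositive.exists
    exact hx
  · simpa using hg.lintegral_trace_lt_top

theorem smul_sandwich (a b : ℂ) (A T B : H →L[ℂ] H) :
    (a • A) * T * (b • B).adjoint = (a * (starRingEnd ℂ) b) • (A * T * B.adjoint) := by
  rw [show (b • B).adjoint = (starRingEnd ℂ) b • B.adjoint from map_smulₛₗ _ _ _]
  simp only [smul_mul_assoc, mul_smul_comm, smul_smul]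
  rw [mul_comm]

theorem continuous_fourier_smul {Φ : Torus → H →L[ℂ] H} (hΦ : Continuous Φ) (t : ℤ) :
    Continuous fun x => (fourier t x : ℂ) • Φ x :=
  (fourier t).continuous.smul hΦ

variable [IsProbabilityMeasure P]

theorem isOperatorDensity_of_isWhiteNoise {W : VectorMeasure Torus (Lp H 2 P)}
    {Z : ℤ → Lp H 2 P} (hZ : IsWhiteNoise P Z) (hW : IsSpectralRepresentation W Z) :
    IsOperatorDensity (fun A => crossCov P (W A) (W A)) AddCircle.haarAddCircle
      fun _ => crossCov P (Z 0) (Z 0) := by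
  obtain ⟨hpos, htr, hcov⟩ := hZ.exists_density
  obtain ⟨hW, hF⟩ := hW
  -- Only one density of the intensity is extracted here; any t would serve.
  obtain ⟨-, μ, g, hμ, hg, -⟩ := hF 0
  have hZ0 : ∀ n, ∫ ω, Z n ω ∂P = 0 := fun n => (hF n).integral_eq_zero hW
  have hlim : ∀ n, IsOpLimit W μ g (fun x => (fourier n x : ℂ) • 1) (Z n) := fun n =>
    (hF n).isOpLimit (continuous_fourier_smul continuous_const n) hg.integrable hg.eq_integral
  have hiso : ∀ n, ∫ x, (fourier n x : ℂ) • g x ∂μ = crossCov P (Z n) (Z 0) := fun n => by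
    rw [crossCov_eq_secondMoment (hZ0 n) (hZ0 0), secondMoment_eq_integral hW hg
      (continuous_fourier_smul continuous_const n) (continuous_fourier_smul continuous_const 0)
      (hlim n) (hlim 0)]
    refine integral_congr_ae (Eventually.of_forall fun x => ?_)
    simp only
    rw [smul_sandwich]
    simp [ContinuousLinearMap.adjoint_one]
  refine ⟨aestronglyMeasurable_const, Eventually.of_forall fun _ => hpos, by simpa using htr,
    fun A hA => ?_⟩
  rw [hg.eq_integral A hA]
  refine setIntegral_eq_of_fourier hg.integrable (integrable_const _) (fun n => ?_) hA
  rw [hiso, hcov]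

theorem isSpectralDensity_of_isFiltered {W : VectorMeasure Torus (Lp H 2 P)}
    (hW : IsCAGOS P W) {S : H →L[ℂ] H}
    (hS : IsOperatorDensity (fun A => crossCov P (W A) (W A)) AddCircle.haarAddCircle fun _ => S)
    {Φ : Torus → H →L[ℂ] H} (hΦ : Continuous Φ) {X : ℤ → Lp H 2 P} (hX : IsFiltered W Φ X) :
    IsSpectralDensity P X fun x => Φ x * S * (Φ x).adjoint := by
  set g : Torus → H →L[ℂ] H := fun x => Φ x * S * (Φ x).adjoint with hgdef
  have hpos : S.IsPositive := hS.isPositive.exists.choose_spec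
  have htr : posTrace S < ∞ := by simpa using hS.lintegral_trace_lt_top
  have hgpos : ∀ x, (g x).IsPositive := fun x => isPositive_sandwich hpos _
  have hgc : Continuous g := (hΦ.mul continuous_const).mul (continuous_adjoint.comp hΦ)
  obtain ⟨C, hC⟩ := isCompact_univ.exists_bound_of_continuousOn hΦ.continuousOn
  have hgtr : ∀ x, posTrace (g x) ≤ ENNReal.ofReal C ^ 2 * posTrace S := fun x => by
    refine (posTrace_sandwich_le hpos _).trans ?_
    gcongr
    rw [← ofReal_norm]
    exact ENNReal.ofReal_le_ofReal (hC x (mem_univ x))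
  have hCtop : ENNReal.ofReal C ^ 2 * posTrace S < ∞ :=
    ENNReal.mul_lt_top (ENNReal.pow_lt_top ENNReal.ofReal_lt_top) htr
  have hgi : Integrable g AddCircle.haarAddCircle := by
    obtain ⟨D, hD⟩ := isCompact_univ.exists_bound_of_continuousOn hgc.continuousOn
    exact Integrable.of_bound hgc.aestronglyMeasurable D
      (Eventually.of_forall fun x => hD x (mem_univ x))
  have hν : ∀ A, MeasurableSet A → (AddCircle.haarAddCircle.withDensityᵥ g : VectorMeasure Torus _) A =
      ∫ x in A, g x ∂AddCircle.haarAddCircle := fun A hA => withDensityᵥ_apply hgi hA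
  have hX0 : ∀ t, ∫ ω, X t ω ∂P = 0 := fun t => (hX t).integral_eq_zero hW
  have hiso : ∀ s t : ℤ, crossCov P (X s) (X t) =
      ∫ x, (fourier (s - t) x : ℂ) • g x ∂AddCircle.haarAddCircle := fun s t => by
    -- All X_t are now limits relative to the same density, and the phases combine to e^{i(s-t)λ},
    -- which yields both stationarity and the spectral measure.
    have hl : ∀ t, IsOpLimit W AddCircle.haarAddCircle (fun _ => S)
        (fun x => (fourier t x : ℂ) • Φ x) (X t) := fun t =>
      (hX t).isOpLimit (continuous_fourier_smul hΦ t) (integrable_const _) hS.eq_integral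
    rw [crossCov_eq_secondMoment (hX0 s) (hX0 t), secondMoment_eq_integral hW hS
      (continuous_fourier_smul hΦ s) (continuous_fourier_smul hΦ t) (hl s) (hl t)]
    refine integral_congr_ae (Eventually.of_forall fun x => ?_)
    simp only
    rw [smul_sandwich, sub_eq_add_neg, fourier_add, fourier_neg]
  refine ⟨AddCircle.haarAddCircle.withDensityᵥ g, ⟨hX0, ⟨fun t => ?_, fun t h => ?_⟩,
    ⟨fun A hA => ?_, fun A hA => ?_⟩, fun n => ?_⟩, ⟨hgc.aestronglyMeasurable,
    Eventually.of_forall hgpos, ?_, hν⟩⟩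
  · rw [hX0, hX0]
  · rw [hiso, hiso, add_sub_cancel_left, sub_zero]
  · rw [hν A hA, ← ContinuousLinearMap.nonneg_iff_isPositive]
    exact integral_nonneg fun x => (ContinuousLinearMap.nonneg_iff_isPositive _).2 (hgpos x)
  · rw [hν A hA]
    exact posTrace_integral_lt_top hgi.restrict hgpos hCtop hgtr
  · rw [hiso, sub_zero]
    exact (integral_withDensityᵥ hgi (fourier n).continuous.stronglyMeasurable zero_le_one
      fun x => (Circle.norm_coe _).le).symm
  · refine (lintegral_mono hgtr).trans_lt ?_
    simpa using hCtop

end SpectralDensity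

/-! ### Transfer functions -/

section Transfer

set_option linter.unusedSectionVars false

variable {H : Type*} [NormedAddCommGroup H] [InnerProductSpace ℂ H] [CompleteSpace H]

theorem differentiable_opEval (p : Polynomial (H →L[ℂ] H)) : Differentiable ℂ (opEval p) := by
  unfold opEval Polynomial.sum
  fun_prop

theorem isUnit_opEval_fourier {d : ℕ} {φ : Polynomial (H →L[ℂ] H)} (hφ : φ ∈ polySetInv H d)
    (x : Torus) : IsUnit (opEval φ (fourier (-1) x)) :=
  hφ.2 _ (Circle.norm_coe _)

theorem continuous_armaTransfer {d : ℕ} {φ : Polynomial (H →L[ℂ] H)} (hφ : φ ∈ polySetInv H d)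
    (θ : Polynomial (H →L[ℂ] H)) : Continuous (armaTransfer φ θ) := by
  have h1 : ∀ p : Polynomial (H →L[ℂ] H), Continuous fun x : Torus => opEval p (fourier (-1) x) :=
    fun p => (differentiable_opEval p).continuous.comp (fourier (-1)).continuous
  refine Continuous.mul (continuous_iff_continuousAt.2 fun x => ?_) (h1 θ)
  obtain ⟨u, hu⟩ := isUnit_opEval_fourier hφ x
  have h2 := NormedRing.inverse_continuousAt u
  rw [hu] at h2
  exact ContinuousAt.comp (f := fun x : Torus => opEval φ (fourier (-1) x)) h2 (h1 φ).continuousAt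

/-- The transfer function extends to complex z through e^{-iz}; it is analytic at 0 because φ(1) is
a unit and inversion is analytic at units. -/
theorem exists_hasSum_armaTransfer {d : ℕ} {φ : Polynomial (H →L[ℂ] H)} (hφ : φ ∈ polySetInv H d)
    (θ : Polynomial (H →L[ℂ] H)) :
    ∃ (a : ℕ → H →L[ℂ] H) (r : ℝ), 0 < r ∧ (Summable fun n => ‖a n‖ * r ^ n) ∧
      ∀ l : ℝ, |l| < r → HasSum (fun n => (l : ℂ) ^ n • a n) (armaTransfer φ θ (l : Torus)) := by
  set F : ℂ → H →L[ℂ] H := fun z => Ring.inverse (opEval φ (Complex.exp (-Complex.I * z))) *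
    opEval θ (Complex.exp (-Complex.I * z)) with hF
  have hp : ∀ p : Polynomial (H →L[ℂ] H),
      AnalyticAt ℂ (fun z : ℂ => opEval p (Complex.exp (-Complex.I * z))) 0 := fun p => by
    have : Differentiable ℂ (fun z : ℂ => opEval p (Complex.exp (-Complex.I * z))) :=
      (differentiable_opEval p).comp (by fun_prop)
    exact this.analyticAt 0
  have hA : AnalyticAt ℂ F 0 := by
    refine AnalyticAt.mul ?_ (hp θ)
    obtain ⟨u, hu⟩ : IsUnit (opEval φ (Complex.exp (-Complex.I * 0))) := hφ.2 _ (by simp)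
    have h2 := analyticAt_inverse (𝕜 := ℂ) u
    rw [hu] at h2
    exact AnalyticAt.comp (f := fun z : ℂ => opEval φ (Complex.exp (-Complex.I * z))) h2 (hp φ)
  obtain ⟨q, ρ, hq⟩ := hA
  -- Taking r strictly inside the disc of convergence gives absolute summability at r itself.
  obtain ⟨r, hr0, hr⟩ := ENNReal.lt_iff_exists_nnreal_btwn.1 hq.r_pos
  have hr0' : (0 : ℝ) < r := by exact_mod_cast hr0
  refine ⟨q.coeff, r, hr0', ?_, fun l hl => ?_⟩
  · simpa using q.summable_norm_mul_pow (hr.trans_le hq.r_le)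
  · have hl' : (l : ℂ) ∈ Metric.eball (0 : ℂ) ρ := by
      refine Metric.eball_subset_eball hr.le ?_
      rw [Metric.mem_eball, edist_zero_right, ← ofReal_norm, Complex.norm_real, Real.norm_eq_abs,
        ← ENNReal.ofReal_coe_nnreal]
      exact (ENNReal.ofReal_lt_ofReal_iff hr0').2 hl
    have h := hq.hasSum hl'
    have e1 : F (0 + (l : ℂ)) = armaTransfer φ θ (l : Torus) := by
      have : (fourier (-1) (l : Torus) : ℂ) = Complex.exp (-Complex.I * l) := by
        rw [fourier_coe_apply]
        congr 1
        have : (Real.pi : ℂ) ≠ 0 := by exact_mod_cast Real.pi_ne_zero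
        push_cast
        field_simp
      rw [hF, armaTransfer, this, zero_add]
    rw [← e1]
    simpa [FormalMultilinearSeries.apply_eq_pow_smul_coeff] using h

end Transfer

/-! ### Kernels of Hilbert-Schmidt operators on `L²` -/

section Kernel

set_option linter.unusedSectionVars false

variable {V : Type*} [MeasurableSpace V] {ξ : Measure V} [SigmaFinite ξ]

theorem memLp_tensor (u w : Lp ℂ 2 ξ) :
    MemLp (fun z : V × V => u z.1 * (starRingEnd ℂ) (w z.2)) 2 (ξ.prod ξ) := by
  have hw : AEStronglyMeasurable (fun v => (starRingEnd ℂ) (w v)) ξ :=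
    Complex.continuous_conj.comp_aestronglyMeasurable (Lp.aestronglyMeasurable w)
  refine (memLp_two_iff_integrable_sq_norm
    ((Lp.aestronglyMeasurable u).comp_fst.mul hw.comp_snd)).2 ?_
  have h : ∀ u : Lp ℂ 2 ξ, Integrable (fun v => ‖u v‖ ^ 2) ξ := fun u =>
    (memLp_two_iff_integrable_sq_norm (Lp.aestronglyMeasurable u)).1 (Lp.memLp u)
  refine ((h u).mul_prod (h w)).congr (Eventually.of_forall fun z => ?_)
  simp [mul_pow]

/-- The function `(v, v') ↦ u(v) conj(w(v'))`. -/
def tensor (u w : Lp ℂ 2 ξ) : Lp ℂ 2 (ξ.prod ξ) := (memLp_tensor u w).toLp _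

theorem coeFn_tensor (u w : Lp ℂ 2 ξ) :
    tensor u w =ᵐ[ξ.prod ξ] fun z => u z.1 * (starRingEnd ℂ) (w z.2) :=
  MemLp.coeFn_toLp _

theorem inner_tensor (u w u' w' : Lp ℂ 2 ξ) :
    ⟪tensor u w, tensor u' w'⟫_ℂ = ⟪u, u'⟫_ℂ * ⟪w', w⟫_ℂ := by
  rw [L2.inner_def, L2.inner_def, L2.inner_def, ← integral_prod_mul]
  refine integral_congr_ae ?_
  filter_upwards [coeFn_tensor u w, coeFn_tensor u' w'] with z h h'
  simp only [h, h', RCLike.inner_apply, map_mul, Complex.conj_conj]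
  ring

theorem tensor_add_left (u u' w : Lp ℂ 2 ξ) : tensor (u + u') w = tensor u w + tensor u' w := by
  apply Lp.ext
  filter_upwards [coeFn_tensor (u + u') w, coeFn_tensor u w, coeFn_tensor u' w,
    Lp.coeFn_add (tensor u w) (tensor u' w),
    Measure.quasiMeasurePreserving_fst.ae_eq_comp (Lp.coeFn_add u u')] with z h1 h2 h3 h4 h5
  simp only [Function.comp_apply, Pi.add_apply] at h5 h4
  rw [h1, h4, h2, h3, h5, add_mul]

theorem tensor_smul_left (c : ℂ) (u w : Lp ℂ 2 ξ) : tensor (c • u) w = c • tensor u w := by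
  apply Lp.ext
  filter_upwards [coeFn_tensor (c • u) w, coeFn_tensor u w, Lp.coeFn_smul c (tensor u w),
    Measure.quasiMeasurePreserving_fst.ae_eq_comp (Lp.coeFn_smul c u)] with z h1 h2 h3 h4
  simp only [Function.comp_apply, Pi.smul_apply, smul_eq_mul] at h3 h4
  rw [h1, h3, h2, h4, mul_assoc]

/-- Tensor product with a fixed unit vector. -/
def tensorIsometry (w : Lp ℂ 2 ξ) (hw : ‖w‖ = 1) : Lp ℂ 2 ξ →ₗᵢ[ℂ] Lp ℂ 2 (ξ.prod ξ) where
  toFun u := tensor u w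
  map_add' u u' := tensor_add_left u u' w
  map_smul' c u := tensor_smul_left c u w
  norm_map' u := by
    refine (sq_eq_sq₀ (norm_nonneg _) (norm_nonneg _)).1 ?_
    have h := inner_tensor u w u w
    rw [inner_self_eq_norm_sq_to_K, inner_self_eq_norm_sq_to_K, inner_self_eq_norm_sq_to_K, hw] at h
    simp only [Complex.coe_algebraMap, Complex.ofReal_one, one_pow, mul_one] at h
    exact_mod_cast h

/-- The spaces L² ⊗ conj(eᵢ) are pairwise orthogonal copies of L², so a square-summable family (T
eᵢ)ᵢ sums to a kernel ∑ᵢ (T eᵢ) ⊗ conj(eᵢ) of the same norm. -/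
theorem orthogonalFamily_tensor :
    OrthogonalFamily ℂ (fun _ : onbIndex (Lp ℂ 2 ξ) => Lp ℂ 2 ξ) fun i =>
      tensorIsometry (onb (Lp ℂ 2 ξ) i) ((onb (Lp ℂ 2 ξ)).orthonormal.1 i) := by
  intro i j hij u u'
  change ⟪tensor u _, tensor u' _⟫_ℂ = 0
  rw [inner_tensor, (onb (Lp ℂ 2 ξ)).orthonormal.2 hij.symm, mul_zero]

/-- The isometry which maps a Hilbert-Schmidt operator on `L²` to its kernel. -/
def HilbertSchmidt.kernel : HilbertSchmidt (Lp ℂ 2 ξ) (Lp ℂ 2 ξ) →L[ℂ] Lp ℂ 2 (ξ.prod ξ) :=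
  LinearMap.mkContinuous
    (orthogonalFamily_tensor.linearIsometry.toLinearMap ∘ₗ HilbertSchmidt.toLp) 1 fun T => by
    rw [one_mul]
    exact (orthogonalFamily_tensor.linearIsometry.norm_map (HilbertSchmidt.toLp T)).le

/-- Expanding f in the basis turns both sides into the same series. -/
theorem HilbertSchmidt.inner_tensor_kernel (T : HilbertSchmidt (Lp ℂ 2 ξ) (Lp ℂ 2 ξ))
    (f g : Lp ℂ 2 ξ) : ⟪tensor g f, T.kernel⟫_ℂ = ⟪g, T.toOp f⟫_ℂ := by
  have h1 : HasSum (fun i => tensor (T.toOp (onb (Lp ℂ 2 ξ) i)) (onb (Lp ℂ 2 ξ) i)) T.kernel :=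
    orthogonalFamily_tensor.hasSum_linearIsometry (HilbertSchmidt.toLp T)
  have h2 := (innerSL ℂ (tensor g f)).hasSum h1
  have h3 := (innerSL ℂ g ∘L T.toOp).hasSum ((onb (Lp ℂ 2 ξ)).hasSum_repr f)
  refine h2.unique (h3.congr_fun fun i => ?_)
  simp [inner_tensor, HilbertBasis.repr_apply_apply, mul_comm]

theorem integrable_kernel_mul {κ : V × V → ℂ} (hκ : MemLp κ 2 (ξ.prod ξ)) (f g : Lp ℂ 2 ξ) :
    Integrable (fun z : V × V => (starRingEnd ℂ) (g z.1) * (κ z * f z.2)) (ξ.prod ξ) := by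
  refine (L2.integrable_inner (𝕜 := ℂ) (tensor g f) (hκ.toLp κ)).congr ?_
  filter_upwards [coeFn_tensor g f, hκ.coeFn_toLp] with z h h'
  simp only [h, h', RCLike.inner_apply, map_mul, Complex.conj_conj]
  ring

theorem inner_tensor_toLp {κ : V × V → ℂ} (hκ : MemLp κ 2 (ξ.prod ξ)) (f g : Lp ℂ 2 ξ) :
    ⟪tensor g f, hκ.toLp κ⟫_ℂ =
      ∫ v, (starRingEnd ℂ) (g v) * ∫ v', κ (v, v') * f v' ∂ξ ∂ξ := by
  have h1 : ⟪tensor g f, hκ.toLp κ⟫_ℂ =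
      ∫ z : V × V, (starRingEnd ℂ) (g z.1) * (κ z * f z.2) ∂(ξ.prod ξ) := by
    rw [L2.inner_def]
    refine integral_congr_ae ?_
    filter_upwards [coeFn_tensor g f, hκ.coeFn_toLp] with z h h'
    simp only [h, h', RCLike.inner_apply, map_mul, Complex.conj_conj]
    ring
  rw [h1, integral_prod _ (integrable_kernel_mul hκ f g)]
  simp only [integral_const_mul]

/-- The weak characterisation of the kernel of an integral operator. -/
theorem apply_ae_eq_integral_iff {κ : V × V → ℂ} (hκ : MemLp κ 2 (ξ.prod ξ))
    (K : Lp ℂ 2 ξ →L[ℂ] Lp ℂ 2 ξ) (f : Lp ℂ 2 ξ) :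
    (K f =ᵐ[ξ] fun v => ∫ v', κ (v, v') * f v' ∂ξ) ↔
      ∀ g : Lp ℂ 2 ξ, ⟪tensor g f, hκ.toLp κ⟫_ℂ = ⟪g, K f⟫_ℂ := by
  constructor
  · intro h g
    rw [inner_tensor_toLp, L2.inner_def]
    refine integral_congr_ae ?_
    filter_upwards [h] with v hv
    rw [RCLike.inner_apply, hv, mul_comm]
  · intro h
    -- Indicators of sets of finite measure are enough as test functions, by σ-finiteness.
    have hind : ∀ {A : Set V} (hA : MeasurableSet A) (hA' : ξ A ≠ ∞) (F : V → ℂ),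
        (fun v => (starRingEnd ℂ) (indicatorConstLp 2 hA hA' (1 : ℂ) v) * F v) =ᵐ[ξ]
          A.indicator F := fun {A} hA hA' F => by
      filter_upwards [indicatorConstLp_coeFn (p := 2) (hs := hA) (hμs := hA') (c := (1 : ℂ))] with v hv
      rw [hv]
      by_cases hvA : v ∈ A <;> simp [hvA]
    refine ae_eq_of_forall_setIntegral_eq_of_sigmaFinite (fun A hA hA' => ?_) (fun A hA hA' => ?_)
      fun A hA hA' => ?_
    · exact integrableOn_Lp_of_measure_ne_top (K f) (by norm_num) hA'.ne
    · rw [← integrable_indicator_iff hA]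
      refine (integrable_congr (hind hA hA'.ne _)).1 ?_
      simpa only [integral_const_mul] using
        (integrable_kernel_mul hκ f (indicatorConstLp 2 hA hA'.ne 1)).integral_prod_left
    · have h1 := h (indicatorConstLp 2 hA hA'.ne 1)
      rw [L2.inner_indicatorConstLp_one, inner_tensor_toLp,
        integral_congr_ae (hind hA hA'.ne _), integral_indicator hA] at h1
      exact h1.symm

/-- Testing on indicators shows that D integrates to 0 over rectangles of finite measure, and
rectangles generate the product σ-algebra. D is only square integrable, so the argument is localised
to an exhausting sequence of squares of finite measure. -/
theorem eq_zero_of_inner_tensor {D : Lp ℂ 2 (ξ.prod ξ)}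
    (h : ∀ f g : Lp ℂ 2 ξ, ⟪tensor g f, D⟫_ℂ = 0) : D = 0 := by
  have hD : MemLp D 2 (ξ.prod ξ) := Lp.memLp D
  have hrect : ∀ {A B : Set V}, MeasurableSet A → MeasurableSet B → ξ A ≠ ∞ → ξ B ≠ ∞ →
      ∫ z in A ×ˢ B, D z ∂(ξ.prod ξ) = 0 := by
    intro A B hA hB hA' hB'
    rw [← h (indicatorConstLp 2 hB hB' 1) (indicatorConstLp 2 hA hA' 1), L2.inner_def,
      ← integral_indicator (hA.prod hB)]
    refine integral_congr_ae ?_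
    filter_upwards [coeFn_tensor (indicatorConstLp 2 hA hA' (1 : ℂ)) (indicatorConstLp 2 hB hB' 1),
      Measure.quasiMeasurePreserving_fst.ae_eq_comp
        (indicatorConstLp_coeFn (p := 2) (hs := hA) (hμs := hA') (c := (1 : ℂ))),
      Measure.quasiMeasurePreserving_snd.ae_eq_comp
        (indicatorConstLp_coeFn (p := 2) (hs := hB) (hμs := hB') (c := (1 : ℂ)))] with z h1 h2 h3
    simp only [Function.comp_apply] at h2 h3
    rw [h1, h2, h3]
    by_cases hz1 : z.1 ∈ A <;> by_cases hz2 : z.2 ∈ B <;> simp [indicator, hz1, hz2]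
  let s : ℕ → Set (V × V) := fun n => spanningSets ξ n ×ˢ spanningSets ξ n
  have hsm : ∀ n, MeasurableSet (s n) := fun n =>
    (measurableSet_spanningSets ξ n).prod (measurableSet_spanningSets ξ n)
  have hs_top : ∀ n, (ξ.prod ξ) (s n) < ∞ := fun n => by
    rw [Measure.prod_prod]
    exact ENNReal.mul_lt_top (measure_spanningSets_lt_top ξ n) (measure_spanningSets_lt_top ξ n)
  have hDn : ∀ n, Integrable D ((ξ.prod ξ).restrict (s n)) := fun n =>
    integrableOn_Lp_of_measure_ne_top D (by norm_num) (hs_top n).ne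
  have hn : ∀ n, ∀ᵐ z ∂(ξ.prod ξ).restrict (s n), D z = 0 := by
    intro n
    have hr : ∀ {A B : Set V}, MeasurableSet A → MeasurableSet B →
        ((ξ.prod ξ).restrict (s n)).withDensityᵥ D (A ×ˢ B) = 0 := fun {A B} hA hB => by
      rw [withDensityᵥ_apply (hDn n) (hA.prod hB), Measure.restrict_restrict (hA.prod hB),
        Set.prod_inter_prod]
      have hfin : ∀ {A : Set V}, ξ (A ∩ spanningSets ξ n) ≠ ∞ := fun {A} =>
        ((measure_mono inter_subset_right).trans_lt (measure_spanningSets_lt_top ξ n)).ne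
      exact hrect (hA.inter (measurableSet_spanningSets ξ n))
        (hB.inter (measurableSet_spanningSets ξ n)) hfin hfin
    have h0 : ((ξ.prod ξ).restrict (s n)).withDensityᵥ D = 0 := by
      refine VectorMeasure.ext_of_generateFrom _ ?_ generateFrom_prod.symm isPiSystem_prod ?_
      · rintro _ ⟨A, hA, B, hB, rfl⟩
        exact hr hA hB
      · rw [← univ_prod_univ]
        exact hr MeasurableSet.univ MeasurableSet.univ
    refine Integrable.ae_eq_of_forall_setIntegral_eq _ (fun _ => (0 : ℂ)) (hDn n) (integrable_zero _ _ _)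
      fun A hA _ => ?_
    rw [← withDensityᵥ_apply (hDn n) hA, h0]
    simp
  have hcov : ⋃ n, s n = univ := by
    refine eq_univ_of_forall fun z => ?_
    have h1 : z.1 ∈ ⋃ n, spanningSets ξ n := by rw [iUnion_spanningSets]; trivial
    have h2 : z.2 ∈ ⋃ n, spanningSets ξ n := by rw [iUnion_spanningSets]; trivial
    obtain ⟨n, hn⟩ := mem_iUnion.1 h1
    obtain ⟨m, hm⟩ := mem_iUnion.1 h2
    exact mem_iUnion.2 ⟨max n m, monotone_spanningSets ξ (le_max_left n m) hn,
      monotone_spanningSets ξ (le_max_right n m) hm⟩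
  have hall := (ae_restrict_iUnion_iff s fun z => D z = 0).2 hn
  rw [hcov, Measure.restrict_univ] at hall
  rw [Lp.eq_zero_iff_ae_eq_zero]
  exact hall

/-- The kernel of an integral operator is unique. -/
theorem ae_eq_of_kernel {κ κ' : V × V → ℂ} (hκ : MemLp κ 2 (ξ.prod ξ))
    (hκ' : MemLp κ' 2 (ξ.prod ξ)) {K : Lp ℂ 2 ξ →L[ℂ] Lp ℂ 2 ξ}
    (h : ∀ f : Lp ℂ 2 ξ, K f =ᵐ[ξ] fun v => ∫ v', κ (v, v') * f v' ∂ξ)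
    (h' : ∀ f : Lp ℂ 2 ξ, K f =ᵐ[ξ] fun v => ∫ v', κ' (v, v') * f v' ∂ξ) :
    κ =ᵐ[ξ.prod ξ] κ' := by
  have : hκ.toLp κ = hκ'.toLp κ' := by
    rw [← sub_eq_zero]
    refine eq_zero_of_inner_tensor fun f g => ?_
    rw [inner_sub_right, (apply_ae_eq_integral_iff hκ K f).1 (h f) g,
      (apply_ae_eq_integral_iff hκ' K f).1 (h' f) g, sub_self]
  exact (MemLp.toLp_eq_toLp_iff hκ hκ').1 this

end Kernel

/-! ### Joint kernels of power series -/

section JointKernel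

/-- A subsequence of the partial sums converges almost everywhere to the L² sum. -/
theorem ae_eq_of_hasSum_Lp {Z : Type*} [MeasurableSpace Z] {m : Measure Z} {u : ℕ → Lp ℂ 2 m}
    {G : Lp ℂ 2 m} (h : HasSum u G) {F : Z → ℂ} (hF : ∀ᵐ z ∂m, HasSum (fun n => u n z) (F z)) :
    F =ᵐ[m] G := by
  have h1 := (Lp.tendsto_Lp_iff_tendsto_eLpNorm' _ _).1 h.tendsto_sum_nat
  have h2 : TendstoInMeasure m (fun N => (∑ n ∈ Finset.range N, u n : Lp ℂ 2 m)) atTop G :=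
    tendstoInMeasure_of_tendsto_eLpNorm (by norm_num) (fun N => Lp.aestronglyMeasurable _)
      (Lp.aestronglyMeasurable _) h1
  obtain ⟨ns, hns, hlim⟩ := h2.exists_seq_tendsto_ae
  have h3 : ∀ᵐ z ∂m, ∀ N, (∑ n ∈ Finset.range N, u n : Lp ℂ 2 m) z =
      ∑ n ∈ Finset.range N, u n z := ae_all_iff.2 fun N => by
    filter_upwards [Lp.coeFn_finsetSum (Finset.range N) u] with z hz
    simpa using hz
  filter_upwards [hF, hlim, h3] with z hz hz' hz3
  refine tendsto_nhds_unique (hz.tendsto_sum_nat.comp hns.tendsto_atTop) (hz'.congr fun k => ?_)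
  exact hz3 _

/-- Minkowski's inequality for a series, by expanding the square and applying Cauchy-Schwarz to each
product. -/
theorem lintegral_tsum_sq_lt_top {Z : Type*} [MeasurableSpace Z] {m : Measure Z}
    {c : ℕ → Lp ℂ 2 m} {η : ℝ} (hη : 0 ≤ η) (hc : Summable fun n => ‖c n‖ * η ^ n) :
    ∫⁻ z, (∑' n, ENNReal.ofReal η ^ n * ‖c n z‖ₑ) ^ 2 ∂m < ∞ := by
  have hm : ∀ n, AEMeasurable (fun z => ENNReal.ofReal η ^ n * ‖c n z‖ₑ) m := fun n =>
    (Lp.aestronglyMeasurable (c n)).enorm.const_mul _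
  have hmm : ∀ n k, AEMeasurable
      (fun z => (ENNReal.ofReal η ^ n * ‖c n z‖ₑ) * (ENNReal.ofReal η ^ k * ‖c k z‖ₑ)) m :=
    fun n k => (hm n).mul (hm k)
  have hfin : ∑' n, ENNReal.ofReal η ^ n * ‖c n‖ₑ ≠ ∞ := by
    have := hc.tsum_ofReal_ne_top
    convert this using 3 with n
    rw [ENNReal.ofReal_mul (norm_nonneg _), ofReal_norm, ENNReal.ofReal_pow hη, mul_comm]
  calc ∫⁻ z, (∑' n, ENNReal.ofReal η ^ n * ‖c n z‖ₑ) ^ 2 ∂m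
      = ∫⁻ z, ∑' n, ∑' k, (ENNReal.ofReal η ^ n * ‖c n z‖ₑ) * (ENNReal.ofReal η ^ k * ‖c k z‖ₑ) ∂m := by
        simp_rw [ENNReal.tsum_mul_left, ENNReal.tsum_mul_right, sq]
    _ = ∑' n, ∑' k, ∫⁻ z, (ENNReal.ofReal η ^ n * ‖c n z‖ₑ) * (ENNReal.ofReal η ^ k * ‖c k z‖ₑ) ∂m := by
        rw [lintegral_tsum fun n => AEMeasurable.tsum (hmm n)]
        exact tsum_congr fun n => lintegral_tsum (hmm n)
    _ ≤ ∑' n, ∑' k, (ENNReal.ofReal η ^ n * ‖c n‖ₑ) * (ENNReal.ofReal η ^ k * ‖c k‖ₑ) := by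
        refine ENNReal.tsum_le_tsum fun n => ENNReal.tsum_le_tsum fun k => ?_
        -- For scalar functions this is the Cauchy-Schwarz inequality.
        have h := lintegral_enorm_rankOne_le (c n) (c k)
        simp_rw [InnerProductSpace.enorm_rankOne] at h
        simp_rw [mul_mul_mul_comm _ ‖c n _‖ₑ]
        rw [lintegral_const_mul' _ _ (by finiteness), mul_mul_mul_comm _ ‖c n‖ₑ]
        gcongr
    _ = (∑' n, ENNReal.ofReal η ^ n * ‖c n‖ₑ) ^ 2 := by
        simp_rw [ENNReal.tsum_mul_left, ENNReal.tsum_mul_right, sq]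
    _ < ∞ := ENNReal.pow_lt_top hfin.lt_top

/-- A power series with coefficients in `L²` has a jointly measurable version, which is dominated
by a square-integrable function. -/
theorem exists_measurable_powerSeries {Z : Type*} [MeasurableSpace Z] {m : Measure Z}
    {c : ℕ → Lp ℂ 2 m} {η : ℝ} (hη : 0 ≤ η) (hc : Summable fun n => ‖c n‖ * η ^ n) :
    ∃ (M : Z → ℝ≥0∞) (F : Z × Ioo (-η) η → ℂ), ∫⁻ z, M z ^ 2 ∂m < ∞ ∧ Measurable F ∧
      (∀ p, ‖F p‖ₑ ≤ M p.1) ∧ ∀ (l : Ioo (-η) η) (G : Lp ℂ 2 m),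
        HasSum (fun n => (l : ℂ) ^ n • c n) G → (fun z => F (z, l)) =ᵐ[m] G := by
  set M : Z → ℝ≥0∞ := fun z => ∑' n, ENNReal.ofReal η ^ n * ‖c n z‖ₑ with hM
  have hcm : ∀ n, Measurable (c n) := fun n => (Lp.stronglyMeasurable (c n)).measurable
  have hMm : Measurable M := Measurable.tsum fun n => (hcm n).enorm.const_mul _
  have hM2 : ∫⁻ z, M z ^ 2 ∂m < ∞ := lintegral_tsum_sq_lt_top hη hc
  have hs : MeasurableSet {z | M z < ∞} := hMm measurableSet_Iio
  -- Cutting the coefficients off on the null set where M is infinite makes the series converge at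
  -- every point, so that its sum is jointly measurable and bounded by M everywhere.
  set c' : ℕ → Z → ℂ := fun n => {z | M z < ∞}.indicator (c n) with hc'
  have hterm : ∀ (p : Z × Ioo (-η) η) n, ‖(p.2 : ℂ) ^ n * c' n p.1‖ₑ ≤
      ENNReal.ofReal η ^ n * ‖c n p.1‖ₑ := fun p n => by
    rw [enorm_mul, enorm_pow]
    gcongr
    · rw [← ofReal_norm, Complex.norm_real]
      exact ENNReal.ofReal_le_ofReal (abs_lt.2 p.2.2).le
    · by_cases hz : M p.1 < ∞ <;> simp [hc', hz]
  have hle : ∀ p : Z × Ioo (-η) η, ∑' n, ‖(p.2 : ℂ) ^ n * c' n p.1‖ₑ ≤ M p.1 := fun p =>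
    ENNReal.tsum_le_tsum (hterm p)
  have hsum : ∀ p : Z × Ioo (-η) η, Summable fun n => (p.2 : ℂ) ^ n * c' n p.1 := fun p => by
    by_cases hz : M p.1 < ∞
    · have h := ((hle p).trans_lt hz).ne
      refine Summable.of_norm ?_
      simpa using ENNReal.summable_toReal h
    · simp [hc', hz]
  refine ⟨M, fun p => ∑' n, (p.2 : ℂ) ^ n * c' n p.1, hM2, ?_, fun p => ?_, fun l G hG => ?_⟩
  · refine measurable_of_tendsto_metrizable (f := fun N (p : Z × Ioo (-η) η) =>
      ∑ n ∈ Finset.range N, (p.2 : ℂ) ^ n * c' n p.1) (fun N => ?_)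
      (tendsto_pi_nhds.2 fun p => (hsum p).hasSum.tendsto_sum_nat)
    refine Finset.measurable_fun_sum _ fun n _ => ?_
    exact ((Complex.measurable_ofReal.comp (measurable_subtype_coe.comp measurable_snd)).pow_const n).mul
      (((hcm n).indicator hs).comp measurable_fst)
  · exact (enorm_tsum_le_tsum_enorm).trans (hle p)
  · refine ae_eq_of_hasSum_Lp hG ?_
    have hfin : ∀ᵐ z ∂m, M z < ∞ := by
      filter_upwards [ae_lt_top' (hMm.pow_const 2).aemeasurable hM2.ne] with z hz
      exact lt_top_iff_ne_top.2 fun h => by simp [h] at hz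
    have hsm : ∀ᵐ z ∂m, ∀ n, ((l : ℂ) ^ n • c n : Lp ℂ 2 m) z = (l : ℂ) ^ n * c n z :=
      ae_all_iff.2 fun n => Lp.coeFn_smul _ _
    filter_upwards [hfin, hsm] with z hz hz'
    refine ((hsum (z, l)).hasSum).congr_fun fun n => ?_
    simp [hz', hc', hz]

instance isFiniteMeasure_lebOn (η : ℝ) : IsFiniteMeasure (lebOn η) := by
  refine ⟨?_⟩
  rw [lebOn, Measure.comap_apply _ Subtype.val_injective
    (fun s hs => (MeasurableEmbedding.subtype_coe measurableSet_Ioo).measurableSet_image.2 hs) _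
    MeasurableSet.univ, image_univ, Subtype.range_coe]
  exact measure_Ioo_lt_top

variable {V : Type*} [MeasurableSpace V] {ξ : Measure V} [SigmaFinite ξ]

theorem exists_isJointKernel {b : ℕ → Lp ℂ 2 ξ →L[ℂ] Lp ℂ 2 ξ} {η : ℝ} (hη : 0 ≤ η)
    (hb : Summable fun n => ‖b n‖ * η ^ n) (R : HilbertSchmidt (Lp ℂ 2 ξ) (Lp ℂ 2 ξ))
    {K : Ioo (-η) η → Lp ℂ 2 ξ →L[ℂ] Lp ℂ 2 ξ}
    (hK : ∀ l : Ioo (-η) η, HasSum (fun n => (l : ℂ) ^ n • b n) (K l)) :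
    ∃ (M : V × V → ℝ≥0∞) (κ : (V × V) × Ioo (-η) η → ℂ), ∫⁻ z, M z ^ 2 ∂(ξ.prod ξ) < ∞ ∧
      (∀ p, ‖κ p‖ₑ ≤ M p.1) ∧ IsJointKernel ξ (fun l => R.mulLeft (K l)) κ := by
  -- Sending A to the kernel of A R is continuous and linear, so it maps the operator power series
  -- to a power series in L².
  set J : (Lp ℂ 2 ξ →L[ℂ] Lp ℂ 2 ξ) →L[ℂ] Lp ℂ 2 (ξ.prod ξ) :=
    HilbertSchmidt.kernel ∘L R.mulLeft with hJ
  have hc : Summable fun n => ‖J (b n)‖ * η ^ n := by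
    refine Summable.of_nonneg_of_le (fun n => by positivity) (fun n => ?_) (hb.mul_left ‖J‖)
    rw [← mul_assoc]
    gcongr
    exact J.le_opNorm _
  obtain ⟨M, κ, hM, hκm, hle, hsum⟩ := exists_measurable_powerSeries hη hc
  have hae : ∀ l, (fun z => κ (z, l)) =ᵐ[ξ.prod ξ] J (K l) := fun l => by
    refine hsum l _ ?_
    simpa using! J.hasSum (hK l)
  have hmem : ∀ l, MemLp (fun z => κ (z, l)) 2 (ξ.prod ξ) := fun l =>
    (memLp_congr_ae (hae l)).2 (Lp.memLp _)
  refine ⟨M, κ, hM, hle, hκm, hmem, fun l f => ?_⟩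
  refine (apply_ae_eq_integral_iff (hmem l) _ f).2 fun g => ?_
  have : (hmem l).toLp _ = (R.mulLeft (K l)).kernel :=
    Lp.ext ((hmem l).coeFn_toLp.trans (hae l))
  rw [this, HilbertSchmidt.inner_tensor_kernel]

theorem IsJointKernel.memLp_and_lintegral_essSup_lt_top {η : ℝ}
    {k : Ioo (-η) η → HilbertSchmidt (Lp ℂ 2 ξ) (Lp ℂ 2 ξ)} {M : V × V → ℝ≥0∞}
    (hM : ∫⁻ z, M z ^ 2 ∂(ξ.prod ξ) < ∞) {κ κ' : (V × V) × Ioo (-η) η → ℂ}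
    (hκ : IsJointKernel ξ k κ) (hle : ∀ p, ‖κ p‖ₑ ≤ M p.1) (hκ' : IsJointKernel ξ k κ') :
    MemLp κ' 2 ((ξ.prod ξ).prod (lebOn η)) ∧
      ∫⁻ z : V × V, essSup (fun x : Ioo (-η) η => ‖κ' (z, x)‖ₑ ^ 2) (lebOn η) ∂(ξ.prod ξ) < ∞ := by
  have h1 : ∀ l, ∀ᵐ z ∂(ξ.prod ξ), κ (z, l) = κ' (z, l) := fun l =>
    ae_eq_of_kernel (hκ.memLp l) (hκ'.memLp l) (hκ.apply_eq l) (hκ'.apply_eq l)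
  -- For each l the exceptional null set in z may vary with l; Fubini exchanges the quantifiers,
  -- leaving a null set of l for almost every z, which the essential supremum does not see.
  have h2 : ∀ᵐ z ∂(ξ.prod ξ), ∀ᵐ l ∂(lebOn η), κ (z, l) = κ' (z, l) :=
    (Measure.ae_ae_comm (p := fun z l => κ (z, l) = κ' (z, l))
      (measurableSet_eq_fun hκ.measurable hκ'.measurable)).2
      (Eventually.of_forall h1)
  have h3 : ∀ᵐ z ∂(ξ.prod ξ), ∀ᵐ l ∂(lebOn η), ‖κ' (z, l)‖ₑ ^ 2 ≤ M z ^ 2 := by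
    filter_upwards [h2] with z hz
    filter_upwards [hz] with l hl
    rw [← hl]
    gcongr
    exact hle (z, l)
  refine ⟨⟨hκ'.measurable.aestronglyMeasurable, ?_⟩, ?_⟩
  · rw [eLpNorm_lt_top_iff_lintegral_rpow_enorm_lt_top (by norm_num) (by norm_num)]
    simp only [ENNReal.toReal_ofNat, ENNReal.rpow_ofNat]
    rw [lintegral_prod _ (hκ'.measurable.enorm.pow_const 2).aemeasurable]
    calc _ ≤ ∫⁻ z, M z ^ 2 * (lebOn η) univ ∂(ξ.prod ξ) := by
          refine lintegral_mono_ae ?_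
          filter_upwards [h3] with z hz
          rw [← lintegral_const]
          exact lintegral_mono_ae hz
      _ = (∫⁻ z, M z ^ 2 ∂(ξ.prod ξ)) * (lebOn η) univ :=
          lintegral_mul_const' _ _ (measure_ne_top _ _)
      _ < ∞ := ENNReal.mul_lt_top hM (measure_lt_top _ _)
  · refine (lintegral_mono_ae ?_).trans_lt hM
    filter_upwards [h3] with z hz
    exact essSup_le_of_ae_le _ hz

end JointKernel

/-! ### Local factorisation of the spectral density -/

section LocalFactor

theorem ae_lebOn_of_ae_haarAddCircle {η : ℝ} (hη : η ∈ Ioo 0 Real.pi) {p : Torus → Prop}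
    (h : ∀ᵐ x ∂(AddCircle.haarAddCircle : Measure Torus), p x) :
    ∀ᵐ x : Ioo (-η) η ∂(lebOn η), p ((x : ℝ) : Torus) := by
  have h1 : ∀ᵐ x ∂(volume : Measure Torus), p x := by
    rw [AddCircle.volume_eq_smul_haarAddCircle]
    exact Measure.ae_smul_measure h _
  -- The fundamental domain (-π, π] is chosen because it contains (-η, η).
  have h2 : ∀ᵐ x : ℝ ∂(volume.restrict (Ioc (-Real.pi) (-Real.pi + 2 * Real.pi))), p (x : Torus) :=
    (AddCircle.measurePreserving_mk (2 * Real.pi) (-Real.pi)).quasiMeasurePreserving.ae h1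
  have h3 : ∀ᵐ x : ℝ ∂(volume.restrict (Ioo (-η) η)), p (x : Torus) := by
    have hsub : Ioo (-η) η ⊆ Ioc (-Real.pi) (-Real.pi + 2 * Real.pi) := fun x hx =>
      ⟨by linarith [hx.1, hη.2], by linarith [hx.2, hη.2]⟩
    exact ae_restrict_of_ae_restrict_of_subset hsub h2
  exact (ae_restrict_iff_subtype measurableSet_Ioo).1 h3

variable {H : Type*} [NormedAddCommGroup H] [InnerProductSpace ℂ H] [CompleteSpace H]

theorem exists_local_expansion {d : ℕ} {φ : Polynomial (H →L[ℂ] H)} (hφ : φ ∈ polySetInv H d)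
    (θ : Polynomial (H →L[ℂ] H)) :
    ∃ η ∈ Ioo 0 Real.pi, ∃ (b : ℕ → H →L[ℂ] H) (K : Ioo (-η) η → H →L[ℂ] H),
      (Summable fun n => ‖b n‖ * η ^ n) ∧ (∀ l : Ioo (-η) η, HasSum (fun n => (l : ℂ) ^ n • b n) (K l)) ∧
      Continuous K ∧ (∃ C, ∀ l, ‖K l‖ ≤ C) ∧
      ∀ l : Ioo (-η) η, armaTransfer φ θ ((l : ℝ) : Torus) =
        Ring.inverse (opEval φ 1) * opEval θ 1 + (l : ℂ) • K l := by
  obtain ⟨a, r, hr, hsum, hT⟩ := exists_hasSum_armaTransfer hφ θ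
  -- The bound by r keeps the interval inside the disc of convergence; the bound by 1 ensures η < π.
  have hη0 : 0 < min r 1 := lt_min hr one_pos
  have hb : Summable fun n => ‖a (n + 1)‖ * (min r 1) ^ n := by
    have h1 : Summable fun n => r⁻¹ * (‖a (n + 1)‖ * r ^ (n + 1)) :=
      ((summable_nat_add_iff 1).2 hsum).mul_left _
    refine h1.of_nonneg_of_le (fun n => by positivity) fun n => ?_
    have : r⁻¹ * (‖a (n + 1)‖ * r ^ (n + 1)) = ‖a (n + 1)‖ * r ^ n := by
      rw [pow_succ]; field_simp
    rw [this]
    gcongr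
    exact min_le_left _ _
  have hle : ∀ (n : ℕ) (l : Ioo (-(min r 1)) (min r 1)),
      ‖(l : ℂ) ^ n • a (n + 1)‖ ≤ ‖a (n + 1)‖ * (min r 1) ^ n := fun n l => by
    rw [norm_smul, norm_pow, Complex.norm_real, mul_comm]
    gcongr
    exact (abs_lt.2 l.2).le
  have hs : ∀ l : Ioo (-(min r 1)) (min r 1), Summable fun n => (l : ℂ) ^ n • a (n + 1) := fun l =>
    Summable.of_norm_bounded hb fun n => hle n l
  refine ⟨min r 1, ⟨hη0, (min_le_right _ _).trans_lt (by linarith [Real.pi_gt_three])⟩,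
    fun n => a (n + 1), fun l : Ioo (-(min r 1)) (min r 1) => ∑' n, (l : ℂ) ^ n • a (n + 1), hb, fun l => (hs l).hasSum,
    ?_, ⟨∑' n, ‖a (n + 1)‖ * (min r 1) ^ n, fun l => ?_⟩, fun l => ?_⟩
  · refine continuous_tsum (fun n => ?_) hb hle
    exact ((Complex.continuous_ofReal.comp continuous_subtype_val).pow n).smul continuous_const
  · exact tsum_of_norm_bounded hb.hasSum fun n => hle n l
  -- The constant coefficient is the value at λ = 0, where e^{-iλ} = 1; removing it and factoring
  -- out λ shifts the coefficients by one.
  · have h0 : a 0 = Ring.inverse (opEval φ 1) * opEval θ 1 := by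
      have h1 := hT 0 (by simpa using hr)
      have h2 : HasSum (fun n => ((0 : ℝ) : ℂ) ^ n • a n) (a 0) := by
        have := hasSum_single (f := fun n => ((0 : ℝ) : ℂ) ^ n • a n) 0 fun n hn => by simp [hn]
        simpa using this
      rw [h2.unique h1, armaTransfer]
      simp
    have h1 := hT l ((abs_lt.2 l.2).trans_le (min_le_left _ _))
    have h2 : HasSum (fun n => (l : ℂ) ^ (n + 1) • a (n + 1))
        ((l : ℂ) • ∑' n, (l : ℂ) ^ n • a (n + 1)) := by
      have := (hs l).hasSum.const_smul (l : ℂ)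
      simpa only [smul_smul, ← pow_succ'] using this
    have h3 := (hasSum_nat_add_iff' 1).2 h1
    rw [Finset.sum_range_one, pow_zero, one_smul] at h3
    rw [h2.unique h3, ← h0]
    abel

theorem armaLocalFactor_mul_adjoint {φ θ : Polynomial (H →L[ℂ] H)} {S : H →L[ℂ] H}
    (hS : S.IsPositive) {R : HilbertSchmidt H H} (hR : R.toOp = CFC.sqrt S) {η : ℝ}
    {K : Ioo (-η) η → H →L[ℂ] H} (x : Ioo (-η) η)
    (hK : armaTransfer φ θ ((x : ℝ) : Torus) =
      Ring.inverse (opEval φ 1) * opEval θ 1 + (x : ℂ) • K x) :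
    armaLocalFactor φ θ S (fun l => R.mulLeft (K l)) x *
        (armaLocalFactor φ θ S (fun l => R.mulLeft (K l)) x).adjoint =
      armaTransfer φ θ ((x : ℝ) : Torus) * S * (armaTransfer φ θ ((x : ℝ) : Torus)).adjoint := by
  rw [sandwich_eq hS]
  have : armaLocalFactor φ θ S (fun l => R.mulLeft (K l)) x =
      armaTransfer φ θ ((x : ℝ) : Torus) * CFC.sqrt S := by
    rw [armaLocalFactor, HilbertSchmidt.toOp_mulLeft, hR, hK, add_mul, smul_mul_assoc]
  rw [this]

variable {Ω : Type*} [MeasurableSpace Ω] {P : Measure Ω} [IsProbabilityMeasure P]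

/-- Spectral density of an ARMA process. -/
theorem IsARMA.isSpectralDensity {d : ℕ} {φ θ : Polynomial (H →L[ℂ] H)} (hφ : φ ∈ polySetInv H d)
    {Z X : ℤ → Lp H 2 P} (hZ : IsWhiteNoise P Z) (hX : IsARMA φ θ Z X) :
    IsSpectralDensity P X fun x =>
      armaTransfer φ θ x * crossCov P (Z 0) (Z 0) * (armaTransfer φ θ x).adjoint := by
  obtain ⟨W, hW, hF⟩ := hX
  exact isSpectralDensity_of_isFiltered hW.1 (isOperatorDensity_of_isWhiteNoise hZ hW)
    (continuous_armaTransfer hφ θ) hF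

theorem IsARMA.ae_eq_localFactor {d : ℕ} {φ θ : Polynomial (H →L[ℂ] H)} (hφ : φ ∈ polySetInv H d)
    {Z X : ℤ → Lp H 2 P} (hZ : IsWhiteNoise P Z) (hX : IsARMA φ θ Z X)
    {R : HilbertSchmidt H H} (hR : R.toOp = CFC.sqrt (crossCov P (Z 0) (Z 0))) {η : ℝ}
    (hη : η ∈ Ioo 0 Real.pi) {K : Ioo (-η) η → H →L[ℂ] H}
    (hK : ∀ x : Ioo (-η) η, armaTransfer φ θ ((x : ℝ) : Torus) =
      Ring.inverse (opEval φ 1) * opEval θ 1 + (x : ℂ) • K x)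
    {g : Torus → H →L[ℂ] H} (hg : IsSpectralDensity P X g) :
    ∀ᵐ (x : Ioo (-η) η) ∂(lebOn η), g ((x : ℝ) : Torus) =
      armaLocalFactor φ θ (crossCov P (Z 0) (Z 0)) (fun l => R.mulLeft (K l)) x *
        (armaLocalFactor φ θ (crossCov P (Z 0) (Z 0)) (fun l => R.mulLeft (K l)) x).adjoint := by
  filter_upwards [ae_lebOn_of_ae_haarAddCircle hη (hg.ae_eq (hX.isSpectralDensity hφ hZ))] with x hx
  rw [hx, armaLocalFactor_mul_adjoint hZ.exists_density.1 hR x (hK x)]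

theorem HilbertSchmidt.exists_norm_mulLeft_le (R : HilbertSchmidt H H) {ι : Type*}
    {K : ι → H →L[ℂ] H} (hK : ∃ C, ∀ l, ‖K l‖ ≤ C) : ∃ C, ∀ l, ‖R.mulLeft (K l)‖ ≤ C := by
  obtain ⟨C, hC⟩ := hK
  exact ⟨‖R.mulLeft‖ * C, fun l => R.mulLeft.le_opNorm_of_le (hC l)⟩

end LocalFactor

end

theorem mainTheorem6 :
    (∀ (H : Type*) [NormedAddCommGroup H] [InnerProductSpace ℂ H] [CompleteSpace H]
      [TopologicalSpace.SeparableSpace H]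
      (Ω : Type*) [MeasurableSpace Ω] (P : Measure Ω) [IsProbabilityMeasure P]
      (p q : ℕ) (φ θ : Polynomial (H →L[ℂ] H)) (_ : φ ∈ polySetInv H p) (_ : θ ∈ polySet H q)
      (Z X : ℤ → Lp H 2 P) (_ : IsWhiteNoise P Z) (_ : IsARMA φ θ Z X)
      (S : H →L[ℂ] H) (_ : S = crossCov P (Z 0) (Z 0)),
      (∃ g, IsSpectralDensity P X g) ∧
      ∃ η ∈ Ioo 0 Real.pi, ∃ k : Ioo (-η) η → HilbertSchmidt H H,
        Continuous k ∧ (∃ C : ℝ, ∀ x, ‖k x‖ ≤ C) ∧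
        ∀ g, IsSpectralDensity P X g → ∀ᵐ (x : Ioo (-η) η) ∂(lebOn η),
          g ((x : ℝ) : Torus) =
            armaLocalFactor φ θ S k x * (armaLocalFactor φ θ S k x).adjoint) ∧
    (∀ (V : Type*) [MeasurableSpace V] (ξ : Measure V) [SigmaFinite ξ]
      [TopologicalSpace.SeparableSpace (Lp ℂ 2 ξ)]
      (Ω : Type*) [MeasurableSpace Ω] (P : Measure Ω) [IsProbabilityMeasure P]
      (p q : ℕ) (φ θ : Polynomial (Lp ℂ 2 ξ →L[ℂ] Lp ℂ 2 ξ))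
      (_ : φ ∈ polySetInv (Lp ℂ 2 ξ) p) (_ : θ ∈ polySet (Lp ℂ 2 ξ) q)
      (Z X : ℤ → Lp (Lp ℂ 2 ξ) 2 P) (_ : IsWhiteNoise P Z) (_ : IsARMA φ θ Z X)
      (S : Lp ℂ 2 ξ →L[ℂ] Lp ℂ 2 ξ) (_ : S = crossCov P (Z 0) (Z 0)),
      (∃ g, IsSpectralDensity P X g) ∧
      ∃ η ∈ Ioo 0 Real.pi, ∃ k : Ioo (-η) η → HilbertSchmidt (Lp ℂ 2 ξ) (Lp ℂ 2 ξ),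
        Continuous k ∧ (∃ C : ℝ, ∀ x, ‖k x‖ ≤ C) ∧
        (∀ g, IsSpectralDensity P X g → ∀ᵐ (x : Ioo (-η) η) ∂(lebOn η),
          g ((x : ℝ) : Torus) =
            armaLocalFactor φ θ S k x * (armaLocalFactor φ θ S k x).adjoint) ∧
        (∃ κ, IsJointKernel ξ k κ) ∧
        ∀ κ, IsJointKernel ξ k κ →
          MemLp κ 2 ((ξ.prod ξ).prod (lebOn η)) ∧
          ∫⁻ z : V × V, essSup (fun x : Ioo (-η) η => ‖κ (z, x)‖ₑ ^ 2) (lebOn η) ∂(ξ.prod ξ) < ∞) := by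
  refine ⟨?_, ?_⟩
  · intro H _ _ _ _ Ω _ P _ p q φ θ hφ hθ Z X hZ hX S hS
    subst hS
    obtain ⟨hpos, htr, -⟩ := hZ.exists_density
    obtain ⟨R, hR⟩ := exists_hilbertSchmidt_sqrt hpos htr
    obtain ⟨η, hη, b, K, -, -, hKc, hKb, hK⟩ := exists_local_expansion hφ θ
    exact ⟨⟨_, hX.isSpectralDensity hφ hZ⟩, η, hη, fun l => R.mulLeft (K l),
      R.mulLeft.continuous.comp hKc, R.exists_norm_mulLeft_le hKb,
      fun g hg => hX.ae_eq_localFactor hφ hZ hR hη hK hg⟩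
  · intro V _ ξ _ _ Ω _ P _ p q φ θ hφ hθ Z X hZ hX S hS
    subst hS
    obtain ⟨hpos, htr, -⟩ := hZ.exists_density
    obtain ⟨R, hR⟩ := exists_hilbertSchmidt_sqrt hpos htr
    obtain ⟨η, hη, b, K, hb, hbK, hKc, hKb, hK⟩ := exists_local_expansion hφ θ
    obtain ⟨M, κ, hM, hle, hκ⟩ := exists_isJointKernel hη.1.le hb R hbK
    exact ⟨⟨_, hX.isSpectralDensity hφ hZ⟩, η, hη, fun l => R.mulLeft (K l),
      R.mulLeft.continuous.comp hKc, R.exists_norm_mulLeft_le hKb,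
      fun g hg => hX.ae_eq_localFactor hφ hZ hR hη hK hg, ⟨κ, hκ⟩,
      fun κ' hκ' => hκ.memLp_and_lintegral_essSup_lt_top hM hle hκ'⟩
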